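/- For an integral $m\times n$ matrix $S$ without zero columns and an integer $q\ge 1$ put $$\chi_S(q)=\bigl|\{\mathbf z\in(\mathbb Z/q\mathbb Z)^m:\ \text{every entry of }\mathbf zS\text{ is nonzero in }\mathbb Z/q\mathbb Z\}\bigr|,\qquad \Phi_S(t)=\sum_{q\ge1}\chi_S(q)\,t^q\in\mathbb Z[[t]].$$ For a nonempty set $J$ of columns let $e(J)$ be the largest elementary divisor (the last entry $e_\ell$ of $e_1\mid\dots\mid e_\ell$ in the Smith normal form over $\mathbb Z$) of the submatrix $S_J$ of $S$ formed by the columns in $J$; put $E_k(S)=\{e(J): 1\le |J|\le k\}$, and let the lcm period $\rho_0(S)$ be the least common multiple of all $e(J)$, $J\neq\emptyset$. For $d\mid\rho_0(S)$ the constituent $P_d$ is the polynomial with $\chi_S(q)=P_d(q)$ for all $q\in d+\rho_0(S)\mathbb Z_{\ge0}$. For $m\ge4$ the mid-hyperplane arrangement $\mathcal M_m$ in $\mathbb R^m$ consists of the hyperplanes $\alpha_i=\alpha_j$ ($i<j$) and $\alpha_i+\alpha_j=\alpha_k+\alpha_l$ ($i<j$, $i<k<l$, $j\ne k,l$); let $T_m$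 be its coefficient matrix, with one column for each hyperplane, namely the coefficient vector of $\alpha_i-\alpha_j$, respectively of $\alpha_i+\alpha_j-\alpha_k-\alpha_l$. **(a)** For $S=T_4$: $E_1=\{1\}$, $E_2=E_3=E_4=\{1,2\}$, $\rho_0=2$, and for all $q\ge 1$ $$\chi_{T_4}(q)=\begin{cases}q^4-9q^3+23q^2-15q=q(q-1)(q-3)(q-5),& q\text{ odd},\\ q^4-9q^3+26q^2-24q=q(q-2)(q-3)(q-4),& q\text{ even},\end{cases}$$ $$\Phi_{T_4}(t)=\frac{48t^6(t^3+5t^2+7t+3)}{(1-t^2)^5}=\frac{48t^6(t+3)}{(1-t)^5(1+t)^3}.$$ **(b)** For $S=T_5$: $E_1=\{1\}$, $E_2=\{1,2\}$, $E_3=\{1,2,3\}$, $E_4=E_5=\{1,2,3,4,5,6\}$, $\rho_0=60$. For every $q\ge1$, $\chi_{T_5}(q)=P_{\gcd(60,q)}(q)$, and the constituents $P_d$, $d\mid 60$, are \begin{align*} P_{1}(q)&=q^5-25q^4+215q^3-695q^2+504q=q(q-1)(q-7)(q-8)(q-9),\\ P_{2}(q)&=q^5-25q^4+230q^3-920q^2+1104q=q(q-2)(q^3-23q^2+184q-552),\\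 P_{3}(q)&=q^5-25q^4+215q^3-735q^2+864q=q(q-3)(q-9)(q^2-13q+32),\\ P_{4}(q)&=q^5-25q^4+230q^3-920q^2+1344q=q(q-4)(q-6)(q-7)(q-8),\\ P_{5}(q)&=q^5-25q^4+215q^3-695q^2+600q=q(q-5)(q^3-20q^2+115q-120),\\ P_{6}(q)&=q^5-25q^4+230q^3-960q^2+1584q=q(q-6)(q^3-19q^2+116q-264),\\ P_{10}(q)&=q^5-25q^4+230q^3-920q^2+1200q=q(q-10)(q^3-15q^2+80q-120),\\ P_{12}(q)&=q^5-25q^4+230q^3-960q^2+1824q=q(q^4-25q^3+230q^2-960q+1824),\\ P_{15}(q)&=q^5-25q^4+215q^3-735q^2+960q=q(q^4-25q^3+215q^2-735q+960),\\ P_{20}(q)&=q^5-25q^4+230q^3-920q^2+1440q=q(q^4-25q^3+230q^2-920q+1440),\\ P_{30}(q)&=q^5-25q^4+230q^3-960q^2+1680q=q(q^4-25q^3+230q^2-960q+1680),\\ P_{60}(q)&=q^5-25q^4+230q^3-960q^2+1920q=q(q^4-25q^3+230q^2-960q+1920). \end{align*} They satisfy $P_d+P_{d'}-P_{dd'}-P_1=0$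 for $(d,d')=(2,5),(3,5),(4,5),(5,6),(5,12)$, and $P_d(t)+P_{d'}(t)-P_{dd'}(t)-P_1(t)=-120t$ for $(d,d')=(2,3),(2,15),(3,4),(3,10),(3,20),(4,15)$. Moreover $\Phi_{T_5}(t)=N(t)/D(t)$ with \begin{align*} N(t)={}&240t^{11}(6t^{20}+40t^{19}+112t^{18}+282t^{17}+511t^{16}+917t^{15}+1301t^{14}+1818t^{13}+2163t^{12}+2493t^{11}\\ &+2479t^{10}+2462t^9+2078t^8+1734t^7+1263t^6+903t^5+523t^4+308t^3+137t^2+59t+11),\\ D(t)={}&(1-t)^6(1+t)^4(1-t+t^2)^2(1+t+t^2)^3(1+t^2)^2(1+t+t^2+t^3+t^4)^2. \end{align*} -/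

import Mathlib

open Polynomial

namespace MidHyperplane

section Matrices

variable {ι κ : Type} [Fintype ι] [DecidableEq ι] [Fintype κ] [DecidableEq κ]

/-- The set `M_q(S)` of row vectors `z` over `ℤ/qℤ` such that every entry of `z S` is nonzero. -/
def complementMod (S : Matrix ι κ ℤ) (q : ℕ) : Set (ι → ZMod q) :=
  {z | ∀ j, Matrix.vecMul z (S.map (Int.cast : ℤ → ZMod q)) j ≠ 0}

/-- The value `χ_S(q) = |M_q(S)|` of the characteristic quasi-polynomial at a positive `q`. -/
noncomputable def charQuasiPoly (S : Matrix ι κ ℤ) (q : ℕ) : ℕ :=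
  Nat.card (complementMod S q)

/-- The generating function `Φ_S(t) = ∑_{q ≥ 1} χ_S(q) t^q`. -/
noncomputable def generatingFunction (S : Matrix ι κ ℤ) : PowerSeries ℤ :=
  PowerSeries.mk fun q => if q = 0 then 0 else (charQuasiPoly S q : ℤ)

/-- `e 0 ∣ e 1 ∣ ⋯ ∣ e (r - 1)` are the elementary divisors of the integral matrix `A`:
`A` is equivalent over `ℤ` to a matrix whose only nonzero entries are the positive integers
`e 0, …, e (r - 1)`, placed in pairwise different rows and pairwise different columns.
In particular `r` is the rank of `A`. -/
def IsElementaryDivisors (A : Matrix ι κ ℤ) {r : ℕ} (e : Fin r → ℕ) : Prop :=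
  (∀ s, 0 < e s) ∧ (∀ s t, s ≤ t → e s ∣ e t) ∧
    ∃ (U : (Matrix ι ι ℤ)ˣ) (V : (Matrix κ κ ℤ)ˣ) (row : Fin r ↪ ι) (col : Fin r ↪ κ),
      ∀ i j, ((U : Matrix ι ι ℤ) * A * (V : Matrix κ κ ℤ)) i j =
        ∑ s, if row s = i ∧ col s = j then (e s : ℤ) else 0

/-- `d` is the last (largest) elementary divisor of the matrix `A`. -/
def IsLastElementaryDivisor (A : Matrix ι κ ℤ) (d : ℕ) : Prop :=
  ∃ (r : ℕ) (e : Fin (r + 1) → ℕ), IsElementaryDivisors A e ∧ d = e (Fin.last r)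

/-- `d = e(J)`: the last elementary divisor of the submatrix `S_J` of the columns in `J`. -/
def IsColumnDivisor (S : Matrix ι κ ℤ) (J : Finset κ) (d : ℕ) : Prop :=
  IsLastElementaryDivisor (S.submatrix id (fun j : {j // j ∈ J} => (j : κ))) d

/-- The set `{e(J) : J ≠ ∅, |J| ≤ k}`. -/
def columnDivisors (S : Matrix ι κ ℤ) (k : ℕ) : Set ℕ :=
  {d | ∃ J : Finset κ, J.Nonempty ∧ J.card ≤ k ∧ IsColumnDivisor S J d}

/-- The lcm period `ρ₀(S)`: the least common multiple of all `e(J)`, `J` nonempty. -/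
noncomputable def lcmPeriod (S : Matrix ι κ ℤ) : ℕ :=
  sInf {N | 0 < N ∧ ∀ (J : Finset κ) (d : ℕ), J.Nonempty → IsColumnDivisor S J d → d ∣ N}

/-- `P` is the constituent `P_{S,d}` of the characteristic quasi-polynomial of `S`:
`χ_S(q) = P(q)` for all `q ∈ d + ρ₀ ℤ_{≥0}`. -/
def IsConstituent (S : Matrix ι κ ℤ) (d : ℕ) (P : ℤ[X]) : Prop :=
  ∀ s : ℕ, (charQuasiPoly S (d + lcmPeriod S * s) : ℤ) =
    P.eval ((d + lcmPeriod S * s : ℕ) : ℤ)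

end Matrices

/-- The hyperplanes of the mid-hyperplane arrangement `M_m`: the `H_{ij}` with `i < j`, and the
`H_{ijkl}` with `i < j`, `i < k < l` and `j ≠ k, l`. -/
abbrev Hyperplanes (m : ℕ) : Type :=
  {p : Fin m × Fin m // p.1 < p.2} ⊕
    {p : Fin m × Fin m × Fin m × Fin m //
      p.1 < p.2.1 ∧ p.1 < p.2.2.1 ∧ p.2.2.1 < p.2.2.2 ∧ p.2.1 ≠ p.2.2.1 ∧ p.2.1 ≠ p.2.2.2}

/-- The column of coefficients of a hyperplane of `M_m`: that of `α_i - α_j` for `H_{ij}`, and that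
of `α_i + α_j - α_k - α_l` for `H_{ijkl}`. -/
def normal {m : ℕ} : Hyperplanes m → Fin m → ℤ
  | .inl ⟨(i, j), _⟩ => Pi.single i 1 - Pi.single j 1
  | .inr ⟨(i, j, k, l), _⟩ => Pi.single i 1 + Pi.single j 1 - Pi.single k 1 - Pi.single l 1

/-- The coefficient matrix `T(M_m)` of the mid-hyperplane arrangement. -/
def coeffMatrix (m : ℕ) : Matrix (Fin m) (Hyperplanes m) ℤ :=
  Matrix.of fun a H => normal H a

/-- The twelve constituents of `M_5`, for `d ∣ 60` (the value at other `d` is irrelevant). -/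
noncomputable def constituentFive : ℕ → ℤ[X]
  | 1 => X ^ 5 - 25 * X ^ 4 + 215 * X ^ 3 - 695 * X ^ 2 + 504 * X
  | 2 => X ^ 5 - 25 * X ^ 4 + 230 * X ^ 3 - 920 * X ^ 2 + 1104 * X
  | 3 => X ^ 5 - 25 * X ^ 4 + 215 * X ^ 3 - 735 * X ^ 2 + 864 * X
  | 4 => X ^ 5 - 25 * X ^ 4 + 230 * X ^ 3 - 920 * X ^ 2 + 1344 * X
  | 5 => X ^ 5 - 25 * X ^ 4 + 215 * X ^ 3 - 695 * X ^ 2 + 600 * X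
  | 6 => X ^ 5 - 25 * X ^ 4 + 230 * X ^ 3 - 960 * X ^ 2 + 1584 * X
  | 10 => X ^ 5 - 25 * X ^ 4 + 230 * X ^ 3 - 920 * X ^ 2 + 1200 * X
  | 12 => X ^ 5 - 25 * X ^ 4 + 230 * X ^ 3 - 960 * X ^ 2 + 1824 * X
  | 15 => X ^ 5 - 25 * X ^ 4 + 215 * X ^ 3 - 735 * X ^ 2 + 960 * X
  | 20 => X ^ 5 - 25 * X ^ 4 + 230 * X ^ 3 - 920 * X ^ 2 + 1440 * X
  | 30 => X ^ 5 - 25 * X ^ 4 + 230 * X ^ 3 - 960 * X ^ 2 + 1680 * X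
  | 60 => X ^ 5 - 25 * X ^ 4 + 230 * X ^ 3 - 960 * X ^ 2 + 1920 * X
  | _ => 0

/-- The factored form in which the twelve constituents of `M_5` are given. -/
noncomputable def factoredConstituentFive : ℕ → ℤ[X]
  | 1 => X * (X - 1) * (X - 7) * (X - 8) * (X - 9)
  | 2 => X * (X - 2) * (X ^ 3 - 23 * X ^ 2 + 184 * X - 552)
  | 3 => X * (X - 3) * (X - 9) * (X ^ 2 - 13 * X + 32)
  | 4 => X * (X - 4) * (X - 6) * (X - 7) * (X - 8)
  | 5 => X * (X - 5) * (X ^ 3 - 20 * X ^ 2 + 115 * X - 120)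
  | 6 => X * (X - 6) * (X ^ 3 - 19 * X ^ 2 + 116 * X - 264)
  | 10 => X * (X - 10) * (X ^ 3 - 15 * X ^ 2 + 80 * X - 120)
  | 12 => X * (X ^ 4 - 25 * X ^ 3 + 230 * X ^ 2 - 960 * X + 1824)
  | 15 => X * (X ^ 4 - 25 * X ^ 3 + 215 * X ^ 2 - 735 * X + 960)
  | 20 => X * (X ^ 4 - 25 * X ^ 3 + 230 * X ^ 2 - 920 * X + 1440)
  | 30 => X * (X ^ 4 - 25 * X ^ 3 + 230 * X ^ 2 - 960 * X + 1680)
  | 60 => X * (X ^ 4 - 25 * X ^ 3 + 230 * X ^ 2 - 960 * X + 1920)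
  | _ => 0

/-- The numerator of the generating function of `M_5`. -/
noncomputable def numeratorFive : ℤ[X] :=
  240 * X ^ 11 * (6 * X ^ 20 + 40 * X ^ 19 + 112 * X ^ 18 + 282 * X ^ 17 + 511 * X ^ 16 +
    917 * X ^ 15 + 1301 * X ^ 14 + 1818 * X ^ 13 + 2163 * X ^ 12 + 2493 * X ^ 11 +
    2479 * X ^ 10 + 2462 * X ^ 9 + 2078 * X ^ 8 + 1734 * X ^ 7 + 1263 * X ^ 6 +
    903 * X ^ 5 + 523 * X ^ 4 + 308 * X ^ 3 + 137 * X ^ 2 + 59 * X + 11)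

/-- The denominator of the generating function of `M_5`. -/
noncomputable def denominatorFive : ℤ[X] :=
  (1 - X) ^ 6 * (1 + X) ^ 4 * (1 - X + X ^ 2) ^ 2 * (1 + X + X ^ 2) ^ 3 *
    (1 + X ^ 2) ^ 2 * (1 + X + X ^ 2 + X ^ 3 + X ^ 4) ^ 2

end MidHyperplane

open MidHyperplane

/-!
Let `T` be the coefficient matrix of the mid-hyperplane arrangement `M_m`. Its columns sum to zero,
so `χ_T(q) = q * χ_S(q)`, where `S` arises from `T` by deleting the last row
(`charQuasiPoly_eq_mul_dropLast`), and `S` has `m - 1` rows.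

*Shape of the quasi-polynomial.* By inclusion–exclusion, `χ_S(q)` is an alternating sum of the
numbers of solutions of the homogeneous systems given by the sets `J` of columns. In coordinates
adapted to the lattice spanned by the columns in `J` such a system is diagonal, and it has
`q ^ (corank J)` times `∏ gcd(q, e_s)` solutions; a function of `gcd(q, n)` is a combination of the
indicator functions of `d ∣ q` with `d ∣ n`. Therefore, if the torsion of the quotient by any
columns of rank `r` has exponent at most `N r`, then the coefficient of `χ_S` in codegree `r` is
`∑ A r d * [d ∣ q]` over `d ≤ N r` (`exists_charQuasiPoly_coeff`).

*Torsion bounds.* By Cramer's rule the exponent of the torsion divides every integer `n` with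
`B * M = n` for some integral `B`, where `M` is a nonsingular square submatrix of maximal size
(`killsTorsion_of_mul_eq`). For a suitable `M` the choice `n = |det M|` is good enough, except for
some `3 × 3` submatrices with determinant `±4` and even adjugate, where `n = 2` works.
The minors are few enough to be inspected by evaluation
(`exists_killsTorsion_four`, `exists_killsTorsion_five`); the bounds for `r = 1, 2, 3, 4`
are `1, 2, 2` for `M_4` and `1, 2, 3, 6` for `M_5`. As the exponent of the torsion is the last
elementary divisor, this bounds the sets `E_k` from above; explicit Smith normal forms show that
nothing is missing, and the lcm periods follow.

*The constituents.* With these bounds `χ_S` has only five unknown coefficients for `M_4`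
and only twelve for `M_5`. They are determined by as many values of `χ_S`, at `q ≤ 5` and at
`q ≤ 14`, most of which vanish (`countFour_eq`, `countFive_eq_zero`, `countFive_eq`).

*Generating functions.* The series `∑ q ^ k * X ^ q` over the multiples `q` of `n` are obtained from
the geometric series by applying the derivation `X * d/dX` (`powerSum_succ_mul`), and the generating
functions are combinations of them.
-/

namespace MidHyperplane

open Module

/-! ### Torsion of quotients and nonzero minors -/

/-- The integer `n` annihilates the torsion subgroup of the quotient `M ⧸ L`. -/
def KillsTorsion {M : Type*} [AddCommGroup M] (L : Submodule ℤ M) (n : ℕ) : Prop :=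
  ∀ (w : M) (k : ℤ), k ≠ 0 → k • w ∈ L → (n : ℤ) • w ∈ L

section Columns

variable {ι κ : Type}

/-- The subgroup of `ℤ^ι` generated by the columns of `S` in `J`. -/
def columnSpan (S : Matrix ι κ ℤ) (J : Set κ) : Submodule ℤ (ι → ℤ) :=
  Submodule.span ℤ (S.col '' J)

/-- The `j`-th column of `S`, with rational entries. -/
def ratColumn (S : Matrix ι κ ℤ) (j : κ) : ι → ℚ := fun i => (S i j : ℚ)

/-- The rank of the columns of `S` in `J`. -/
noncomputable def columnRank (S : Matrix ι κ ℤ) (J : Set κ) : ℕ :=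
  finrank ℚ (Submodule.span ℚ (ratColumn S '' J))

/-- Entrywise inclusion of integral in rational vectors. -/
def ratCast (ι : Type) : (ι → ℤ) →ₗ[ℤ] (ι → ℚ) where
  toFun w i := (w i : ℚ)
  map_add' v w := by ext; simp
  map_smul' k w := by ext; simp

@[simp] lemma ratCast_apply (w : ι → ℤ) (i : ι) : ratCast ι w i = (w i : ℚ) := rfl

lemma ratCast_mem_span_image {X : Set (ι → ℤ)} {w : ι → ℤ} (hw : w ∈ Submodule.span ℤ X) :
    ratCast ι w ∈ Submodule.span ℚ (ratCast ι '' X) := by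
  induction hw using Submodule.span_induction with
  | mem x hx => exact Submodule.subset_span ⟨x, hx, rfl⟩
  | zero => simp
  | add x y _ _ hx hy => rw [map_add]; exact Submodule.add_mem _ hx hy
  | smul k x _ hx =>
    have : ratCast ι (k • x) = (k : ℚ) • ratCast ι x := by ext; simp
    rw [this]; exact Submodule.smul_mem _ _ hx

lemma ratColumn_image (S : Matrix ι κ ℤ) (J : Set κ) :
    ratColumn S '' J = ratCast ι '' (S.col '' J) := by
  rw [Set.image_image]; rfl

lemma ratCast_mem_span {S : Matrix ι κ ℤ} {J : Set κ} {w : ι → ℤ} (hw : w ∈ columnSpan S J) :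
    ratCast ι w ∈ Submodule.span ℚ (ratColumn S '' J) := by
  rw [ratColumn_image]; exact ratCast_mem_span_image hw

/-- Among the columns in `J` there is a `ℚ`-basis of their span, listed in the order of the
enumeration `l`, and among the rows there are as many, in increasing order, on which this basis
has a nonzero minor. -/
lemma exists_nonzero_minor [DecidableEq κ] {m : ℕ} (S : Matrix (Fin m) κ ℤ) (l : List κ)
    (hl : ∀ j, j ∈ l) (J : Finset κ) :
    ∃ (r : ℕ) (c : Fin r → κ) (f : Fin r ↪o Fin m), r = columnRank S J ∧
      (List.ofFn c).Sublist l ∧ (∀ s, c s ∈ J) ∧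
      Submodule.span ℚ (Set.range (ratColumn S ∘ c)) = Submodule.span ℚ (ratColumn S '' J) ∧
      (S.submatrix f c).det ≠ 0 := by
  classical
  obtain ⟨κ', a, ha, hspan, hli⟩ := exists_linearIndependent' ℚ (fun j : J => ratColumn S j)
  have : Finite κ' := Finite.of_injective a ha
  have := Fintype.ofFinite κ'
  let J' : Finset κ := Finset.univ.image fun x => (a x : κ)
  have hJ' : J' ⊆ J := by
    intro j hj
    simp only [J', Finset.mem_image, Finset.mem_univ, true_and] at hj
    obtain ⟨x, rfl⟩ := hj
    exact (a x).2
  obtain ⟨l', hperm, hsub⟩ : J'.toList.Subperm l :=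
    List.subperm_of_subset J'.nodup_toList (fun j _ => hl j)
  let c : Fin l'.length → κ := l'.get
  have hnodup : l'.Nodup := hperm.nodup_iff.2 J'.nodup_toList
  have hc : Function.Injective c := List.nodup_iff_injective_get.1 hnodup
  have hmem : ∀ j, j ∈ l' ↔ j ∈ J' := fun j => by rw [hperm.mem_iff, Finset.mem_toList]
  have hrange : Set.range c = Set.range fun x => (a x : κ) := by
    ext j
    rw [Set.range_list_get]
    simp [hmem, J']
  have hli' : LinearIndependent ℚ (ratColumn S ∘ c) := by
    rw [← linearIndepOn_range_iff hc, hrange, linearIndepOn_range_iff]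
    · exact hli
    · exact Subtype.val_injective.comp ha
  have hsp : Submodule.span ℚ (Set.range (ratColumn S ∘ c)) =
      Submodule.span ℚ (ratColumn S '' J) := by
    rw [Set.range_comp, hrange, ← Set.range_comp]
    refine Eq.trans hspan ?_
    congr 1
    ext v
    simp
  -- The rows of the matrix of the chosen columns span, so that some of them form a basis.
  let A : Matrix (Fin m) (Fin l'.length) ℚ := fun i s => (S i (c s) : ℚ)
  have hrank : A.rank = l'.length := by
    rw [← Matrix.rank_transpose]
    have := LinearIndependent.rank_matrix (M := A.transpose) hli'
    simpa using this
  obtain ⟨κr, b, hb, hbspan, hbli⟩ := exists_linearIndependent' ℚ A.row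
  have : Finite κr := Finite.of_injective b hb
  have := Fintype.ofFinite κr
  have hcard : Fintype.card κr = l'.length := by
    rw [← finrank_span_eq_card hbli, hbspan, ← Matrix.rank_eq_finrank_span_row, hrank]
  let R : Finset (Fin m) := Finset.univ.image b
  have hRcard : R.card = l'.length := by
    rw [Finset.card_image_of_injective _ hb, Finset.card_univ, hcard]
  let f := R.orderEmbOfFin hRcard
  have hfrange : Set.range f = Set.range b := by
    rw [Finset.range_orderEmbOfFin]; simp [R]
  refine ⟨l'.length, c, f, ?_, ?_, fun s => hJ' ((hmem _).1 (List.get_mem _ _)), hsp, ?_⟩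
  · rw [columnRank, ← hsp, finrank_span_eq_card hli', Fintype.card_fin]
  · rw [show List.ofFn c = l' from List.ofFn_get l']; exact hsub
  · have hfli : LinearIndependent ℚ (A.row ∘ f) := by
      rw [← linearIndepOn_range_iff f.injective, hfrange, linearIndepOn_range_iff hb]
      exact hbli
    have hunit : IsUnit (A.submatrix f id) := Matrix.linearIndependent_rows_iff_isUnit.1 hfli
    have hdet : (A.submatrix f id).det ≠ 0 := ((Matrix.isUnit_iff_isUnit_det _).1 hunit).ne_zero
    have hA : A.submatrix f id = (Int.castRingHom ℚ).mapMatrix (S.submatrix f c) := by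
      ext; rfl
    rw [hA, ← RingHom.map_det] at hdet
    intro h
    simp [h] at hdet

/-- If a square submatrix `M` of the columns `c` satisfies `B * M = n` and these columns span those
in `J` rationally, then `n` annihilates the torsion: the coordinates of a vector of the rational
span have denominators dividing `n`, by Cramer's rule. -/
lemma killsTorsion_of_mul_eq {m r : ℕ} (S : Matrix (Fin m) κ ℤ) (J : Set κ) (c : Fin r → κ)
    (hcJ : ∀ s, c s ∈ J) (f : Fin r → Fin m)
    (hspan : Submodule.span ℚ (Set.range (ratColumn S ∘ c)) =
      Submodule.span ℚ (ratColumn S '' J))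
    (B : Matrix (Fin r) (Fin r) ℤ) (n : ℕ) (hB : B * S.submatrix f c = (n : ℤ) • 1) :
    KillsTorsion (columnSpan S J) n := by
  intro w k hk hw
  have hw' : ratCast _ w ∈ Submodule.span ℚ (Set.range (ratColumn S ∘ c)) := by
    rw [hspan]
    have h := ratCast_mem_span hw
    have hkw : ratCast _ (k • w) = (k : ℚ) • ratCast _ w := by ext; simp
    rw [hkw] at h
    exact (Submodule.smul_mem_iff _ (by exact_mod_cast hk)).1 h
  obtain ⟨x, hx⟩ := (Submodule.mem_span_range_iff_exists_fun ℚ).1 hw'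
  have hxi : ∀ i, (w i : ℚ) = ∑ s, x s * S i (c s) := by
    intro i
    have := congrFun hx i
    simp [ratColumn] at this
    rw [← this]
  let y : Fin r → ℤ := B.mulVec (fun s => w (f s))
  have hy : ∀ s, (y s : ℚ) = n * x s := by
    intro s
    have hBq : ∀ t, ∑ u, (B s u : ℚ) * S (f u) (c t) = if s = t then (n : ℚ) else 0 := by
      intro t
      have := congrFun (congrFun hB s) t
      simp only [Matrix.mul_apply, Matrix.submatrix_apply, Matrix.smul_apply, Matrix.one_apply,
        smul_eq_mul, mul_ite, mul_one, mul_zero] at this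
      have h2 := congrArg (Int.cast : ℤ → ℚ) this
      push_cast at h2
      exact h2
    calc (y s : ℚ) = ∑ u, (B s u : ℚ) * ∑ t, x t * S (f u) (c t) := by
          simp only [y, Matrix.mulVec, dotProduct]; push_cast
          exact Finset.sum_congr rfl fun u _ => by rw [hxi]
      _ = ∑ t, x t * ∑ u, (B s u : ℚ) * S (f u) (c t) := by
          simp only [Finset.mul_sum]
          rw [Finset.sum_comm]
          exact Finset.sum_congr rfl fun _ _ => Finset.sum_congr rfl fun _ _ => by ring
      _ = n * x s := by simp only [hBq]; simp [mul_comm]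
  have hnw : (n : ℤ) • w = ∑ s, y s • S.col (c s) := by
    ext i
    have : (((n : ℤ) • w) i : ℚ) = ((∑ s, y s • S.col (c s)) i : ℤ) := by
      simp only [Pi.smul_apply, smul_eq_mul, Finset.sum_apply, Matrix.col_apply]
      push_cast
      rw [hxi, Finset.mul_sum]
      exact Finset.sum_congr rfl fun s _ => by rw [hy]; ring
    exact_mod_cast this
  rw [hnw]
  exact Submodule.sum_mem _ fun s _ =>
    Submodule.smul_mem _ _ (Submodule.subset_span ⟨c s, hcJ s, rfl⟩)

end Columns

/-! ### The coefficients of a characteristic quasi-polynomial -/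

section Counting

/-- Every function of the positive integers is a divisor sum, by Möbius inversion. -/
lemma exists_divisorSum_eq (G : ℕ → ℤ) : ∃ a : ℕ → ℤ, ∀ n > 0, ∑ d ∈ n.divisors, a d = G n :=
  ⟨fun n => ∑ x ∈ n.divisorsAntidiagonal, ArithmeticFunction.moebius x.1 * G x.2,
    ArithmeticFunction.sum_eq_iff_sum_mul_moebius_eq.2 fun _ _ => rfl⟩

lemma card_zsmul_eq_zero (q : ℕ) [NeZero q] (a : ℤ) :
    Nat.card {x : ZMod q // a • x = 0} = q.gcd a.natAbs := by
  have h := IsAddCyclic.card_nsmulAddMonoidHom_ker (ZMod q) a.natAbs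
  rw [Nat.card_zmod] at h
  rw [← h]
  refine Nat.card_congr (Equiv.subtypeEquivRight fun x => ?_)
  rw [AddMonoidHom.mem_ker, nsmulAddMonoidHom_apply]
  rcases Int.natAbs_eq a with h | h
  · conv_lhs => rw [h]
    rw [natCast_zsmul]
  · conv_lhs => rw [h]
    rw [neg_smul, natCast_zsmul, neg_eq_zero]

variable {ι κ : Type}

/-- The number of invariant factors of the lattice spanned by the columns is their rational rank. -/
lemma snf_card_eq_columnRank (S : Matrix ι κ ℤ) (J : Set κ) {k : ℕ}
    (snf : Basis.SmithNormalForm (columnSpan S J) ι k) : k = columnRank S J := by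
  let u : Fin k → ι → ℤ := fun s => (snf.bN s : ι → ℤ)
  have hu : LinearIndependent ℤ u :=
    snf.bN.linearIndependent.map' (columnSpan S J).subtype (Submodule.ker_subtype _)
  have huspan : Submodule.span ℤ (Set.range u) = columnSpan S J := by
    have h := congrArg (Submodule.map (columnSpan S J).subtype) snf.bN.span_eq
    rw [Submodule.map_span, ← Set.range_comp, Submodule.map_top, Submodule.range_subtype] at h
    exact h
  have hinj : LinearMap.ker (ratCast ι) = ⊥ := by
    rw [LinearMap.ker_eq_bot]
    intro v w h
    ext i
    have := congrFun h i
    simpa using this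
  have huq : LinearIndependent ℚ (ratCast ι ∘ u) :=
    (LinearIndependent.iff_fractionRing ℤ ℚ).1 (hu.map' _ hinj)
  have hspan : Submodule.span ℚ (Set.range (ratCast ι ∘ u)) =
      Submodule.span ℚ (ratColumn S '' J) := by
    apply le_antisymm
    · rw [Submodule.span_le]
      rintro _ ⟨s, rfl⟩
      exact ratCast_mem_span (snf.bN s).2
    · rw [Submodule.span_le]
      rintro _ ⟨j, hj, rfl⟩
      have h : S.col j ∈ Submodule.span ℤ (Set.range u) := by
        rw [huspan]; exact Submodule.subset_span ⟨j, hj, rfl⟩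
      rw [Set.range_comp]
      exact ratCast_mem_span_image h
  rw [columnRank, ← hspan, finrank_span_eq_card huq, Fintype.card_fin]

/-- The solutions of the homogeneous system given by the columns in `J`. -/
def solutionsMod [Fintype ι] (S : Matrix ι κ ℤ) (q : ℕ) (J : Set κ) : Set (ι → ZMod q) :=
  {z | ∀ j ∈ J, Matrix.vecMul z (S.map (Int.cast : ℤ → ZMod q)) j = 0}

/-- If `n` annihilates the torsion of the quotient by the columns in `J`, then the number of
solutions modulo `q` of the corresponding homogeneous system is `q ^ (corank)` times a function of
`gcd q n`, which is the number of homomorphisms from the torsion subgroup to `ℤ/qℤ`. -/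
lemma card_solutionsMod [Fintype ι] (S : Matrix ι κ ℤ) (J : Set κ) {n N : ℕ} (hn : 0 < n)
    (hnN : n ≤ N) (hkill : KillsTorsion (columnSpan S J) n) :
    ∃ a : ℕ → ℤ, ∀ q : ℕ, 0 < q → (Nat.card (solutionsMod S q J) : ℤ) =
      q ^ (Fintype.card ι - columnRank S J) *
        ∑ d ∈ Finset.Icc 1 N, if d ∣ q then a d else 0 := by
  classical
  -- `snf.bM` is a basis of `ℤ^ι` such that the vectors `snf.a s • snf.bM (snf.f s)` form a basis of
  -- the column span; the numbers `snf.a s` are the invariant factors.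
  obtain ⟨k, snf⟩ := (columnSpan S J).smithNormalForm (Pi.basisFun ℤ ι)
  have hk := snf_card_eq_columnRank S J snf
  have hadvd : ∀ s, (snf.a s).natAbs ∣ n := by
    intro s
    have hne : snf.a s ≠ 0 := by
      intro h0
      have h1 := snf.snf s
      rw [h0, zero_smul] at h1
      exact snf.bN.ne_zero s (Subtype.ext h1)
    have hmem : (n : ℤ) • snf.bM (snf.f s) ∈ columnSpan S J := by
      refine hkill _ (snf.a s) hne ?_
      rw [← snf.snf]; exact (snf.bN s).2
    let y : columnSpan S J := ⟨_, hmem⟩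
    have h2 : (n : ℤ) • snf.bM (snf.f s) = ∑ t, snf.bN.repr y t • (snf.a t • snf.bM (snf.f t)) := by
      have h3 := congrArg (Subtype.val) (snf.bN.sum_repr y)
      rw [AddSubmonoidClass.coe_finsetSum] at h3
      rw [show (n : ℤ) • snf.bM (snf.f s) = (y : ι → ℤ) from rfl, ← h3]
      exact Finset.sum_congr rfl fun t _ => by rw [← snf.snf]; rfl
    have h4 := congrArg (fun w => snf.bM.repr w (snf.f s)) h2
    simp only [map_smul, map_sum, Basis.repr_self, Finsupp.smul_apply, Finsupp.single_apply,
      Finsupp.coe_finsetSum, Finset.sum_apply, snf.f.injective.eq_iff, if_true, smul_eq_mul,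
      mul_ite, mul_one, mul_zero, Finset.sum_ite_eq', Finset.mem_univ] at h4
    rw [← Int.natCast_dvd_natCast, Int.natAbs_dvd]
    exact ⟨_, by rw [h4, mul_comm]⟩
  obtain ⟨a, ha⟩ := exists_divisorSum_eq fun g => ∏ s, (g.gcd (snf.a s).natAbs : ℤ)
  refine ⟨fun d => if d ∣ n then a d else 0, fun q hq => ?_⟩
  have : NeZero q := ⟨hq.ne'⟩
  have hsum : (∑ d ∈ Finset.Icc 1 N, if d ∣ q then (if d ∣ n then a d else 0) else 0) =
      ∏ s, (q.gcd (snf.a s).natAbs : ℤ) := by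
    have h := ha (q.gcd n) (Nat.gcd_pos_of_pos_left _ hq)
    have h2 : ∀ s, (q.gcd n).gcd (snf.a s).natAbs = q.gcd (snf.a s).natAbs := fun s => by
      rw [Nat.gcd_assoc, Nat.gcd_eq_right (hadvd s)]
    simp only [h2] at h
    rw [← h, ← Finset.sum_filter, ← Finset.sum_filter, Finset.filter_filter]
    refine Finset.sum_congr ?_ fun _ _ => rfl
    ext d
    simp only [Finset.mem_filter, Finset.mem_Icc, Nat.mem_divisors, Nat.dvd_gcd_iff]
    constructor
    · rintro ⟨_, h⟩; exact ⟨h, (Nat.gcd_pos_of_pos_left _ hq).ne'⟩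
    · rintro ⟨h, _⟩
      exact ⟨⟨Nat.pos_of_dvd_of_pos h.1 hq, (Nat.le_of_dvd hn h.2).trans hnN⟩, h⟩
  rw [hsum, ← hk]
  -- In the coordinates given by the adapted basis the system is diagonal.
  let ψ := (Pi.basisFun ℤ ι).constr (M' := ZMod q) ℤ
  let E : (ι → ZMod q) ≃ (ι → ZMod q) := (ψ.trans (snf.bM.constr ℤ).symm).toEquiv
  have hE : ∀ z i, E z i = ψ z (snf.bM i) := fun z i => rfl
  have hψ : ∀ z j, Matrix.vecMul z (S.map (Int.cast : ℤ → ZMod q)) j = ψ z (S.col j) := by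
    intro z j
    simp [ψ, Basis.constr_apply_fintype, Matrix.vecMul, dotProduct, mul_comm]
  have hmem : ∀ z, z ∈ solutionsMod S q J ↔ ∀ i, ∀ s, snf.f s = i → snf.a s • E z i = 0 := by
    intro z
    have h1 : z ∈ solutionsMod S q J ↔ columnSpan S J ≤ LinearMap.ker (ψ z) := by
      rw [columnSpan, Submodule.span_le]
      constructor
      · rintro h _ ⟨j, hj, rfl⟩
        exact (hψ z j).symm.trans (h j hj)
      · intro h j hj
        exact (hψ z j).trans (h ⟨j, hj, rfl⟩)
    rw [h1]
    constructor
    · rintro h _ s rfl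
      rw [hE, ← map_smul, ← snf.snf]
      exact h (snf.bN s).2
    · intro h w hw
      have h3 := congrArg (Subtype.val) (snf.bN.sum_repr ⟨w, hw⟩)
      rw [AddSubmonoidClass.coe_finsetSum] at h3
      change _ = w at h3
      rw [LinearMap.mem_ker, ← h3, map_sum]
      refine Finset.sum_eq_zero fun s _ => ?_
      have h4 : ψ z (snf.bN s : ι → ℤ) = 0 := by
        rw [snf.snf, map_smul, ← hE]; exact h _ s rfl
      rw [Submodule.coe_smul, map_smul, h4, smul_zero]
  have hcard : Nat.card (solutionsMod S q J) =
      ∏ i, Nat.card {x : ZMod q // ∀ s, snf.f s = i → snf.a s • x = 0} := by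
    rw [← Nat.card_pi]
    refine Nat.card_congr (Equiv.trans (E.subtypeEquiv (q := fun y => ∀ i s, snf.f s = i →
      snf.a s • y i = 0) hmem)
      (Equiv.subtypePiEquivPi (p := fun i x => ∀ s, snf.f s = i → snf.a s • x = 0)))
  rw [hcard, ← Finset.prod_mul_prod_compl (Finset.univ.map snf.f), Finset.prod_map, mul_comm]
  push_cast
  congr 1
  · have : ∀ i ∈ (Finset.univ.map snf.f)ᶜ,
        (Nat.card {x : ZMod q // ∀ s, snf.f s = i → snf.a s • x = 0} : ℤ) = q := by
      intro i hi
      have hi' : ∀ s, snf.f s ≠ i := by simpa using hi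
      rw [Nat.card_congr (Equiv.subtypeUnivEquiv fun x s hs => absurd hs (hi' s)), Nat.card_zmod]
    rw [Finset.prod_congr rfl this, Finset.prod_const, Finset.card_compl, Finset.card_map,
      Finset.card_univ, Fintype.card_fin]
  · refine Finset.prod_congr rfl fun s _ => ?_
    rw [← card_zsmul_eq_zero]
    congr 1
    refine Nat.card_congr (Equiv.subtypeEquivRight fun x => ?_)
    constructor
    · intro h; exact h s rfl
    · intro h t ht; rw [snf.f.injective ht]; exact h

lemma columnRank_le_card [Fintype ι] (S : Matrix ι κ ℤ) (J : Set κ) :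
    columnRank S J ≤ Fintype.card ι := by
  rw [columnRank, ← finrank_fintype_fun_eq_card ℚ]
  exact Submodule.finrank_le _

lemma eq_empty_of_columnRank_eq_zero [Fintype ι] {S : Matrix ι κ ℤ} (hS : ∀ j, S.col j ≠ 0)
    {J : Set κ} (hJ : columnRank S J = 0) : J = ∅ := by
  rw [columnRank, Submodule.finrank_eq_zero, Submodule.span_eq_bot] at hJ
  by_contra hne
  obtain ⟨j, hj⟩ := Set.nonempty_iff_ne_empty.2 hne
  refine hS j (funext fun i => ?_)
  have := congrFun (hJ _ ⟨j, hj, rfl⟩) i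
  simpa [ratColumn] using this

/-- Inclusion–exclusion over the hyperplanes. -/
lemma charQuasiPoly_eq_sum_solutionsMod [Fintype ι] [DecidableEq ι] [Fintype κ] [DecidableEq κ]
    (S : Matrix ι κ ℤ) (q : ℕ) [NeZero q] :
    (charQuasiPoly S q : ℤ) =
      ∑ J : Finset κ, (-1) ^ J.card * (Nat.card (solutionsMod S q J) : ℤ) := by
  classical
  let Z : κ → Finset (ι → ZMod q) := fun j =>
    Finset.univ.filter fun z => Matrix.vecMul z (S.map (Int.cast : ℤ → ZMod q)) j = 0
  have h := Finset.inclusion_exclusion_card_inf_compl Finset.univ Z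
  rw [Finset.powerset_univ] at h
  have hl : charQuasiPoly S q = (Finset.univ.inf fun j => (Z j)ᶜ).card := by
    rw [charQuasiPoly, Nat.card_coe_set_eq, ← Set.ncard_coe_finset]
    congr 1
    ext z
    simp [complementMod, Z, Finset.mem_inf]
  have hr : ∀ J : Finset κ, Nat.card (solutionsMod S q J) = (J.inf Z).card := by
    intro J
    rw [Nat.card_coe_set_eq, ← Set.ncard_coe_finset]
    congr 1
    ext z
    simp [solutionsMod, Z, Finset.mem_inf]
  simp only [hl, hr]
  exact h

/-- If the torsion of the quotient by any set of columns of rank `r` is annihilated by a positive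
integer that is at most `N r`, then the coefficient of the characteristic quasi-polynomial in
codegree `r` is a combination of the indicator functions of `d ∣ q` with `d ≤ N r`. -/
theorem exists_charQuasiPoly_coeff [Fintype ι] [DecidableEq ι] [Fintype κ] [DecidableEq κ]
    (S : Matrix ι κ ℤ) (hS : ∀ j, S.col j ≠ 0) (N : ℕ → ℕ) (hN0 : N 0 = 1)
    (hN : ∀ J : Finset κ, ∃ n, 0 < n ∧ n ≤ N (columnRank S J) ∧
      KillsTorsion (columnSpan S J) n) :
    ∃ A : ℕ → ℕ → ℤ, A 0 1 = 1 ∧ ∀ q : ℕ, 0 < q → (charQuasiPoly S q : ℤ) =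
      ∑ r ∈ Finset.range (Fintype.card ι + 1), (q : ℤ) ^ (Fintype.card ι - r) *
        ∑ d ∈ Finset.Icc 1 (N r), if d ∣ q then A r d else 0 := by
  classical
  have hJ : ∀ J : Finset κ, ∃ a : ℕ → ℤ, ∀ q : ℕ, 0 < q →
      (Nat.card (solutionsMod S q J) : ℤ) = q ^ (Fintype.card ι - columnRank S J) *
        ∑ d ∈ Finset.Icc 1 (N (columnRank S J)), if d ∣ q then a d else 0 := by
    intro J
    obtain ⟨n, hn, hnN, hk⟩ := hN J
    exact card_solutionsMod S J hn hnN hk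
  choose a ha using hJ
  refine ⟨fun r d => ∑ J : Finset κ, if columnRank S J = r then (-1) ^ J.card * a J d else 0,
    ?_, fun q hq => ?_⟩
  · beta_reduce
    rw [Finset.sum_eq_single (∅ : Finset κ)]
    · have h := ha ∅ 1 one_pos
      have h0 : columnRank S ((∅ : Finset κ) : Set κ) = 0 := by simp [columnRank]
      have h1 : solutionsMod S 1 ((∅ : Finset κ) : Set κ) = Set.univ := by
        simp [solutionsMod]
      rw [h0, hN0, h1] at h
      rw [if_pos h0]
      simpa using h.symm
    · intro J _ hJ
      rw [if_neg]
      intro h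
      exact hJ (Finset.coe_eq_empty.1 (eq_empty_of_columnRank_eq_zero hS h))
    · simp
  · have : NeZero q := ⟨hq.ne'⟩
    rw [charQuasiPoly_eq_sum_solutionsMod]
    have hterm : ∀ J : Finset κ, (-1) ^ J.card * (Nat.card (solutionsMod S q J) : ℤ) =
        ∑ r ∈ Finset.range (Fintype.card ι + 1), (q : ℤ) ^ (Fintype.card ι - r) *
          ∑ d ∈ Finset.Icc 1 (N r), if d ∣ q then
            (if columnRank S J = r then (-1) ^ J.card * a J d else 0) else 0 := by
      intro J
      rw [Finset.sum_eq_single (columnRank S J)]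
      · rw [ha J q hq, mul_left_comm]
        congr 1
        rw [Finset.mul_sum]
        refine Finset.sum_congr rfl fun d _ => ?_
        rw [if_pos rfl, mul_ite, mul_zero]
      · intro r _ hr
        simp [hr.symm]
      · intro h
        exact absurd (Finset.mem_range.2 (Nat.lt_succ_of_le (columnRank_le_card S J))) h
    rw [Finset.sum_congr rfl fun J _ => hterm J, Finset.sum_comm]
    refine Finset.sum_congr rfl fun r _ => ?_
    rw [← Finset.mul_sum, Finset.sum_comm]
    congr 1
    refine Finset.sum_congr rfl fun d _ => ?_
    split_ifs <;> simp

/-- The matrix `S` without its last row. If the columns of `S` sum to zero, then it describes the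
quotient of the arrangement of `S` by the diagonal line. -/
def dropLast {m : ℕ} (S : Matrix (Fin (m + 1)) κ ℤ) : Matrix (Fin m) κ ℤ :=
  S.submatrix Fin.castSucc id

/-- The entries of `z S` depend only on the differences `z i - z (last)`, while the last coordinate
of `z` is free. -/
lemma charQuasiPoly_eq_mul_dropLast {m : ℕ} [Fintype κ] [DecidableEq κ]
    (S : Matrix (Fin (m + 1)) κ ℤ) (hS : ∀ j, ∑ i, S i j = 0) (q : ℕ) :
    charQuasiPoly S q = q * charQuasiPoly (dropLast S) q := by
  have key : ∀ z : Fin (m + 1) → ZMod q, ∀ j,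
      Matrix.vecMul z (S.map (Int.cast : ℤ → ZMod q)) j =
      Matrix.vecMul (fun i => z (Fin.castSucc i) - z (Fin.last m))
        ((dropLast S).map (Int.cast : ℤ → ZMod q)) j := by
    intro z j
    have h : (∑ i, (S i j : ZMod q)) = 0 := by
      exact_mod_cast congrArg (Int.cast : ℤ → ZMod q) (hS j)
    rw [Fin.sum_univ_castSucc] at h
    simp only [Matrix.vecMul, dotProduct, Matrix.map_apply, dropLast, Matrix.submatrix_apply, id,
      sub_mul, Finset.sum_sub_distrib, ← Finset.mul_sum, Fin.sum_univ_castSucc]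
    rw [eq_neg_of_add_eq_zero_left h]
    ring
  let e : complementMod S q ≃ ZMod q × complementMod (dropLast S) q :=
    { toFun := fun z => (z.1 (Fin.last m), ⟨fun i => z.1 (Fin.castSucc i) - z.1 (Fin.last m),
        fun j => (key z.1 j) ▸ z.2 j⟩)
      invFun := fun p => ⟨Fin.snoc (α := fun _ => ZMod q) (fun i => p.2.1 i + p.1) p.1, fun j => by
        rw [key]; simpa using p.2.2 j⟩
      left_inv := fun z => by
        ext i
        refine Fin.lastCases ?_ (fun i => ?_) i <;> simp
      right_inv := fun p => by
        refine Prod.ext (by simp) (Subtype.ext (funext fun i => by simp)) }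
  rw [charQuasiPoly, Nat.card_congr e, Nat.card_prod, Nat.card_zmod]
  rfl

end Counting

/-! ### Last elementary divisors -/

section Divisors

variable {ι κ : Type}

lemma columnRank_le_card_columns [DecidableEq κ] (S : Matrix ι κ ℤ) (J : Finset κ) :
    columnRank S J ≤ J.card := by
  classical
  rw [columnRank, ← Finset.coe_image]
  exact (finrank_span_finset_le_card _).trans Finset.card_image_le

/-- On vectors with vanishing coordinate sum, forgetting the last coordinate is injective. -/
lemma killsTorsion_of_dropLast {m : ℕ} {S : Matrix (Fin (m + 1)) κ ℤ}
    (hS : ∀ j, ∑ i, S i j = 0) {J : Set κ} {n : ℕ}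
    (h : KillsTorsion (columnSpan (dropLast S) J) n) : KillsTorsion (columnSpan S J) n := by
  let π : (Fin (m + 1) → ℤ) →ₗ[ℤ] (Fin m → ℤ) := LinearMap.funLeft ℤ ℤ Fin.castSucc
  have hmap : columnSpan (dropLast S) J = (columnSpan S J).map π := by
    rw [columnSpan, columnSpan, Submodule.map_span, Set.image_image]; rfl
  have hsum : ∀ w ∈ columnSpan S J, ∑ i, w i = 0 := by
    intro w hw
    induction hw using Submodule.span_induction with
    | mem x hx => obtain ⟨j, _, rfl⟩ := hx; exact hS j
    | zero => simp
    | add x y _ _ hx hy => simp [Finset.sum_add_distrib, hx, hy]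
    | smul k x _ hx => simp [← Finset.mul_sum, hx]
  intro w k hk hw
  have hw0 : ∑ i, w i = 0 := by
    have := hsum _ hw
    simp only [Pi.smul_apply, smul_eq_mul, ← Finset.mul_sum, mul_eq_zero] at this
    exact this.resolve_left hk
  have h1 : (n : ℤ) • π w ∈ (columnSpan S J).map π := by
    rw [← hmap]
    refine h (π w) k hk ?_
    rw [hmap, ← map_smul]
    exact Submodule.mem_map_of_mem hw
  obtain ⟨v, hv, hvw⟩ := h1
  have hv0 := hsum v hv
  have hi : ∀ i : Fin m, v (Fin.castSucc i) = n * w (Fin.castSucc i) := fun i => congrFun hvw i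
  have : (n : ℤ) • w = v := by
    funext i
    refine Fin.lastCases ?_ (fun i => (hi i).symm) i
    rw [Fin.sum_univ_castSucc] at hv0 hw0
    simp only [hi, ← Finset.mul_sum] at hv0
    simp only [Pi.smul_apply, smul_eq_mul]
    linear_combination (n : ℤ) * hw0 - hv0
  rw [this]
  exact hv

lemma columnSpan_submatrix (S : Matrix ι κ ℤ) (J : Finset κ) :
    columnSpan (S.submatrix id (fun j : {j // j ∈ J} => (j : κ))) Set.univ = columnSpan S J := by
  rw [columnSpan, columnSpan]
  congr 1
  ext v
  constructor
  · rintro ⟨j, -, rfl⟩; exact ⟨j, j.2, rfl⟩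
  · rintro ⟨j, hj, rfl⟩; exact ⟨⟨j, hj⟩, trivial, rfl⟩

variable [Fintype ι] [DecidableEq ι] [DecidableEq κ]

/-- The column `row s` of `U⁻¹` is a vector of which precisely the multiples by multiples of `e s`
lie in the column span. -/
lemma IsElementaryDivisors.dvd_of_killsTorsion [Fintype κ] {A : Matrix ι κ ℤ} {r : ℕ}
    {e : Fin r → ℕ} (h : IsElementaryDivisors A e) {n : ℕ}
    (hn : KillsTorsion (columnSpan A Set.univ) n) (s : Fin r) : e s ∣ n := by
  obtain ⟨hpos, -, U, V, row, col, hUV⟩ := h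
  have hmemA : ∀ x : κ → ℤ, A.mulVec x ∈ columnSpan A Set.univ := by
    intro x
    have : A.mulVec x = ∑ j, x j • A.col j := by
      ext i
      simp [Matrix.mulVec, dotProduct, mul_comm]
    rw [this]
    exact Submodule.sum_mem _ fun j _ =>
      Submodule.smul_mem _ _ (Submodule.subset_span ⟨j, trivial, rfl⟩)
  have hA : ∀ w ∈ columnSpan A Set.univ, ∃ x : κ → ℤ, w = A.mulVec x := by
    intro w hw
    induction hw using Submodule.span_induction with
    | mem x hx =>
      obtain ⟨j, _, rfl⟩ := hx
      exact ⟨Pi.single j 1, by simp⟩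
    | zero => exact ⟨0, by simp⟩
    | add x y _ _ hx hy =>
      obtain ⟨a, rfl⟩ := hx; obtain ⟨b, rfl⟩ := hy
      exact ⟨a + b, by rw [Matrix.mulVec_add]⟩
    | smul k x _ hx =>
      obtain ⟨a, rfl⟩ := hx
      exact ⟨k • a, by rw [Matrix.mulVec_smul]⟩
  let D : Matrix ι κ ℤ := (U : Matrix ι ι ℤ) * A * (V : Matrix κ κ ℤ)
  have hD : ∀ i j, D i j = ∑ s, if row s = i ∧ col s = j then (e s : ℤ) else 0 := hUV
  have hUU : (U : Matrix ι ι ℤ) * (↑U⁻¹ : Matrix ι ι ℤ) = 1 := U.mul_inv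
  have hUU' : (↑U⁻¹ : Matrix ι ι ℤ) * (U : Matrix ι ι ℤ) = 1 := U.inv_mul
  have hVV : (V : Matrix κ κ ℤ) * (↑V⁻¹ : Matrix κ κ ℤ) = 1 := V.mul_inv
  let w : ι → ℤ := (↑U⁻¹ : Matrix ι ι ℤ).mulVec (Pi.single (row s) 1)
  have hw : (e s : ℤ) • w = A.mulVec ((V : Matrix κ κ ℤ).mulVec (Pi.single (col s) 1)) := by
    have h1 : D.mulVec (Pi.single (col s) 1) = (e s : ℤ) • Pi.single (row s) 1 := by
      ext i
      rw [Matrix.mulVec_single_one]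
      simp only [Matrix.col_apply, hD, Pi.smul_apply, Pi.single_apply, smul_eq_mul, mul_ite,
        mul_one, mul_zero, col.injective.eq_iff]
      rw [Finset.sum_eq_single s]
      · simp [eq_comm]
      · intro t _ ht; simp [ht]
      · simp
    have h2 : A * (V : Matrix κ κ ℤ) = (↑U⁻¹ : Matrix ι ι ℤ) * D := by
      simp only [D]
      rw [← Matrix.mul_assoc, ← Matrix.mul_assoc, hUU', Matrix.one_mul]
    rw [Matrix.mulVec_mulVec, h2, ← Matrix.mulVec_mulVec, h1, Matrix.mulVec_smul]
  have hmem : (n : ℤ) • w ∈ columnSpan A Set.univ :=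
    hn w (e s) (by exact_mod_cast (hpos s).ne') (hw ▸ hmemA _)
  obtain ⟨x, hx⟩ := hA _ hmem
  have h3 : (n : ℤ) • Pi.single (row s) (1 : ℤ) =
      D.mulVec ((↑V⁻¹ : Matrix κ κ ℤ).mulVec x) := by
    have : (n : ℤ) • Pi.single (row s) (1 : ℤ) = (U : Matrix ι ι ℤ).mulVec ((n : ℤ) • w) := by
      rw [Matrix.mulVec_smul, Matrix.mulVec_mulVec, hUU, Matrix.one_mulVec]
    rw [this, hx, Matrix.mulVec_mulVec, Matrix.mulVec_mulVec]
    simp only [D]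
    rw [Matrix.mul_assoc, hVV, Matrix.mul_one]
  have h4 := congrFun h3 (row s)
  simp only [Pi.smul_apply, Pi.single_eq_same, smul_eq_mul, mul_one] at h4
  rw [← Int.natCast_dvd_natCast, h4]
  refine Finset.dvd_sum fun j _ => Dvd.dvd.mul_right ?_ _
  change (e s : ℤ) ∣ D (row s) j
  rw [hD]
  refine Finset.dvd_sum fun t _ => ?_
  split_ifs with ht
  · rw [row.injective ht.1]
  · exact dvd_zero _

lemma IsColumnDivisor.pos {S : Matrix ι κ ℤ} {J : Finset κ} {d : ℕ}
    (h : IsColumnDivisor S J d) : 0 < d := by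
  obtain ⟨r, e, he, rfl⟩ := h
  exact he.1 _

lemma IsColumnDivisor.dvd_of_killsTorsion {S : Matrix ι κ ℤ} {J : Finset κ} {d n : ℕ}
    (h : IsColumnDivisor S J d) (hn : KillsTorsion (columnSpan S J) n) : d ∣ n := by
  obtain ⟨r, e, he, rfl⟩ := h
  rw [← columnSpan_submatrix] at hn
  exact he.dvd_of_killsTorsion hn _

/-- The last elementary divisor of the columns `c 0, …, c k`, read off from matrices `U` and `V`
that transform them into diagonal form. -/
lemma exists_isColumnDivisor {m k : ℕ} (S : Matrix (Fin m) κ ℤ) (c : Fin (k + 1) → κ)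
    (hc : Function.Injective c) (hkm : k + 1 ≤ m) (U U' : Matrix (Fin m) (Fin m) ℤ)
    (V V' : Matrix (Fin (k + 1)) (Fin (k + 1)) ℤ) (hU : U * U' = 1) (hV : V * V' = 1)
    (e : Fin (k + 1) → ℕ) (hpos : ∀ s, 0 < e s) (hdvd : ∀ s t, s ≤ t → e s ∣ e t)
    (h : U * S.submatrix id c * V = Matrix.of fun i j =>
      if i = Fin.castLE hkm j then (e j : ℤ) else 0) :
    ∃ J : Finset κ, J.Nonempty ∧ J.card = k + 1 ∧ IsColumnDivisor S J (e (Fin.last k)) := by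
  let E : Fin (k + 1) ≃ {j // j ∈ Finset.univ.image c} :=
    Equiv.ofBijective (fun s => ⟨c s, by simp⟩)
      ⟨fun s t h => hc (congrArg Subtype.val h), fun ⟨j, hj⟩ => by
        obtain ⟨s, -, hs⟩ := Finset.mem_image.1 hj
        exact ⟨s, Subtype.ext hs⟩⟩
  have hV2 : V.submatrix E.symm E.symm * V'.submatrix E.symm E.symm = 1 := by
    rw [Matrix.submatrix_mul_equiv, hV, Matrix.submatrix_one_equiv]
  refine ⟨Finset.univ.image c, Finset.univ_nonempty.image c,
    by rw [Finset.card_image_of_injective _ hc, Finset.card_fin], k, e,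
    ⟨hpos, hdvd, ⟨U, U', hU, mul_eq_one_comm.1 hU⟩,
    ⟨V.submatrix E.symm E.symm, V'.submatrix E.symm E.symm, hV2, mul_eq_one_comm.1 hV2⟩,
    Fin.castLEEmb hkm, E.toEmbedding, fun i j => ?_⟩, rfl⟩
  obtain ⟨s, rfl⟩ := E.surjective j
  have h1 : S.submatrix id (fun j : {j // j ∈ Finset.univ.image c} => (j : κ)) =
      (S.submatrix id c).submatrix id E.symm := by
    ext i j
    obtain ⟨t, rfl⟩ := E.surjective j
    simp only [Matrix.submatrix_apply, id, Equiv.symm_apply_apply]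
    rfl
  have h2 : U * (S.submatrix id fun j : {j // j ∈ Finset.univ.image c} => (j : κ)) *
      V.submatrix E.symm E.symm = (U * S.submatrix id c * V).submatrix id E.symm := by
    rw [h1, ← Matrix.submatrix_mul_equiv _ V id E.symm E.symm]
    rfl
  change (U * (S.submatrix id fun j : {j // j ∈ Finset.univ.image c} => (j : κ)) *
      V.submatrix E.symm E.symm) i (E s) = _
  rw [h2, h]
  simp only [Matrix.submatrix_apply, id, Equiv.symm_apply_apply, Matrix.of_apply,
    Equiv.coe_toEmbedding, E.injective.eq_iff, Fin.castLEEmb_apply]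
  rw [Finset.sum_eq_single s]
  · simp [eq_comm]
  · intro t _ ht; simp [ht]
  · simp

end Divisors

/-! ### Minors of lists of vectors -/

section Minors

/-- `P a t` holds for every decomposition `l = s ++ a :: t`. -/
def allSuffixes {α : Type} (P : α → List α → Bool) : List α → Bool
  | [] => true
  | a :: t => P a t && allSuffixes P t

lemma exists_of_allSuffixes {α : Type} {P : α → List α → Bool} {l : List α}
    (h : allSuffixes P l = true) {a : α} {s : List α} (hs : (a :: s).Sublist l) :
    ∃ t, P a t = true ∧ s.Sublist t := by
  induction l with
  | nil => cases hs
  | cons b t ih =>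
    rw [allSuffixes, Bool.and_eq_true] at h
    cases hs with
    | cons _ hs => exact ih h.2 hs
    | cons_cons _ hs => exact ⟨t, h.1, hs⟩

/-- Integral vectors with four coordinates, in a form suited to evaluation. -/
abbrev Quad : Type := ℤ × ℤ × ℤ × ℤ

/-- The coordinates of a quadruple. -/
def Quad.coord (v : Quad) : Fin 4 → ℤ := ![v.1, v.2.1, v.2.2.1, v.2.2.2]

/-- The `3 × 3` determinant with columns `a`, `b`, `c`. -/
def det3 (a0 a1 a2 b0 b1 b2 c0 c1 c2 : ℤ) : ℤ :=
  a0 * (b1 * c2 - b2 * c1) + a1 * (b2 * c0 - b0 * c2) + a2 * (b0 * c1 - b1 * c0)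

/-- The `3 × 3` determinant with columns `a`, `b`, `c` is nonzero, and either it is at most `N` in
absolute value, or it is at most `2 * N` and the adjugate is divisible by `2`. In the latter case
half of the determinant is a common denominator of the entries of the inverse. -/
def smallDet3 (N : ℕ) (a0 a1 a2 b0 b1 b2 c0 c1 c2 : ℤ) : Bool :=
  let d := (det3 a0 a1 a2 b0 b1 b2 c0 c1 c2).natAbs
  Nat.ble 1 d && (Nat.ble d N || (Nat.ble d (2 * N) &&
    [b1 * c2 - b2 * c1, b2 * c0 - b0 * c2, b0 * c1 - b1 * c0,
      c1 * a2 - c2 * a1, c2 * a0 - c0 * a2, c0 * a1 - c1 * a0,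
      a1 * b2 - a2 * b1, a2 * b0 - a0 * b2, a0 * b1 - a1 * b0].all fun x =>
        Nat.beq (Nat.mod x.natAbs 2) 0))

/-- All entries of the vectors in the list are at most `1` in absolute value. -/
def checkEntries (l : List Quad) : Bool :=
  allSuffixes (fun (a0, a1, a2, a3) _ =>
    [a0, a1, a2, a3].all fun x => Nat.ble x.natAbs 1) l

/-- All `2 × 2` minors of pairs from the list are at most `2` in absolute value. -/
def checkMinors2 (l : List Quad) : Bool :=
  allSuffixes (fun (a0, a1, a2, a3) => allSuffixes fun (b0, b1, b2, b3) _ =>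
    [a0 * b1 - a1 * b0, a0 * b2 - a2 * b0, a0 * b3 - a3 * b0, a1 * b2 - a2 * b1,
      a1 * b3 - a3 * b1, a2 * b3 - a3 * b2].all fun x => Nat.ble x.natAbs 2) l

/-- For all triples from the list, one of the `3 × 3` minors satisfies `smallDet3 N` or all of them
vanish. A single minor suffices, because the rows can be chosen freely in Cramer's rule. -/
def checkMinors3 (N : ℕ) (l : List Quad) : Bool :=
  allSuffixes (fun (a0, a1, a2, a3) => allSuffixes fun (b0, b1, b2, b3) =>
    allSuffixes fun (c0, c1, c2, c3) _ =>
      smallDet3 N a0 a1 a2 b0 b1 b2 c0 c1 c2 || (smallDet3 N a0 a1 a3 b0 b1 b3 c0 c1 c3 ||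
      (smallDet3 N a0 a2 a3 b0 b2 b3 c0 c2 c3 || (smallDet3 N a1 a2 a3 b1 b2 b3 c1 c2 c3 ||
      [det3 a0 a1 a2 b0 b1 b2 c0 c1 c2, det3 a0 a1 a3 b0 b1 b3 c0 c1 c3,
        det3 a0 a2 a3 b0 b2 b3 c0 c2 c3, det3 a1 a2 a3 b1 b2 b3 c1 c2 c3].all fun x =>
          Nat.beq x.natAbs 0)))) l

/-- All `4 × 4` determinants of quadruples from the list are at most `6` in absolute value. The
minors of the first two and three vectors are computed once. -/
def checkMinors4 (l : List Quad) : Bool :=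
  allSuffixes (fun (a0, a1, a2, a3) => allSuffixes fun (b0, b1, b2, b3) =>
    let p01 := a0 * b1 - a1 * b0
    let p02 := a0 * b2 - a2 * b0
    let p03 := a0 * b3 - a3 * b0
    let p12 := a1 * b2 - a2 * b1
    let p13 := a1 * b3 - a3 * b1
    let p23 := a2 * b3 - a3 * b2
    allSuffixes fun (c0, c1, c2, c3) =>
      let q0 := c1 * p23 - c2 * p13 + c3 * p12
      let q1 := c0 * p23 - c2 * p03 + c3 * p02
      let q2 := c0 * p13 - c1 * p03 + c3 * p01
      let q3 := c0 * p12 - c1 * p02 + c2 * p01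
      allSuffixes fun (d0, d1, d2, d3) _ =>
        Nat.ble (d3 * q3 - d2 * q2 + d1 * q1 - d0 * q0).natAbs 6) l

/-- Some integral matrix `B` satisfies `B * M = n` with `0 < n ≤ N`. -/
def HasDenominator {r : ℕ} (M : Matrix (Fin r) (Fin r) ℤ) (N : ℕ) : Prop :=
  ∃ n : ℕ, 0 < n ∧ n ≤ N ∧ ∃ B : Matrix (Fin r) (Fin r) ℤ, B * M = (n : ℤ) • 1

lemma hasDenominator_of_mul_eq {r : ℕ} {M B : Matrix (Fin r) (Fin r) ℤ} {d : ℤ} (hd : d ≠ 0)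
    (h : B * M = d • 1) {N : ℕ} (hN : d.natAbs ≤ N) : HasDenominator M N := by
  refine ⟨d.natAbs, Int.natAbs_pos.2 hd, hN, ?_⟩
  rcases Int.natAbs_eq d with h1 | h1
  · exact ⟨B, by rw [h, ← h1]⟩
  · exact ⟨-B, by rw [Matrix.neg_mul, h, ← neg_smul]; congr 1; omega⟩

lemma hasDenominator_of_det {r : ℕ} {M : Matrix (Fin r) (Fin r) ℤ} {N : ℕ} (h0 : M.det ≠ 0)
    (h : M.det.natAbs ≤ N) : HasDenominator M N :=
  hasDenominator_of_mul_eq h0 M.adjugate_mul h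

lemma hasDenominator_of_even_adjugate {r : ℕ} {M : Matrix (Fin (r + 1)) (Fin (r + 1)) ℤ} {N : ℕ}
    (h0 : M.det ≠ 0) (h : M.det.natAbs ≤ 2 * N) (heven : ∀ i j, (2 : ℤ) ∣ M.adjugate i j) :
    HasDenominator M N := by
  choose b hb using heven
  have hB : M.adjugate = (2 : ℤ) • Matrix.of b := by
    ext i j; simp [hb]
  have hmul := M.adjugate_mul
  rw [hB, Matrix.smul_mul] at hmul
  obtain ⟨d, hd⟩ : (2 : ℤ) ∣ M.det := by
    have := congrFun (congrFun hmul 0) 0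
    simp only [Matrix.smul_apply, Matrix.one_apply_eq, smul_eq_mul, mul_one] at this
    exact ⟨_, this.symm⟩
  rw [hd, mul_smul] at hmul
  have hmul' : Matrix.of b * M = d • 1 := by
    ext i j
    have := congrFun (congrFun hmul i) j
    simp only [Matrix.smul_apply, smul_eq_mul] at this
    simp only [Matrix.smul_apply, smul_eq_mul]
    omega
  exact hasDenominator_of_mul_eq (by rintro rfl; simp at hd; exact h0 hd) hmul' (by omega)

lemma HasDenominator.det_ne_zero {r : ℕ} {M : Matrix (Fin r) (Fin r) ℤ} {N : ℕ}
    (h : HasDenominator M N) : M.det ≠ 0 := by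
  obtain ⟨n, hn, -, B, hB⟩ := h
  intro h0
  have := congrArg Matrix.det hB
  rw [Matrix.det_mul, h0, mul_zero, Matrix.det_smul, Matrix.det_one, mul_one] at this
  exact pow_ne_zero _ (by exact_mod_cast hn.ne') this.symm

lemma det3_eq_det (M : Matrix (Fin 3) (Fin 3) ℤ) :
    det3 (M 0 0) (M 1 0) (M 2 0) (M 0 1) (M 1 1) (M 2 1) (M 0 2) (M 1 2) (M 2 2) = M.det := by
  rw [Matrix.det_fin_three, det3]; ring

lemma hasDenominator_of_smallDet3 {N : ℕ} (M : Matrix (Fin 3) (Fin 3) ℤ)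
    (h : smallDet3 N (M 0 0) (M 1 0) (M 2 0) (M 0 1) (M 1 1) (M 2 1) (M 0 2) (M 1 2) (M 2 2)) :
    HasDenominator M N := by
  simp only [smallDet3, det3_eq_det, Bool.or_eq_true, Nat.ble_eq, Bool.and_eq_true, List.all_cons,
    List.all_nil, Bool.and_true] at h
  obtain ⟨h0, h⟩ := h
  have h0 : M.det ≠ 0 := by omega
  rcases h with h | ⟨h, h1⟩
  · exact hasDenominator_of_det h0 h
  · refine hasDenominator_of_even_adjugate h0 h ?_
    have hmod : ∀ x y : ℤ, Nat.beq (Nat.mod x.natAbs 2) 0 = true → y = x → (2 : ℤ) ∣ y := by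
      rintro _ x hx rfl
      have : x.natAbs % 2 = 0 := Nat.eq_of_beq_eq_true hx
      omega
    obtain ⟨e0, e1, e2, e3, e4, e5, e6, e7, e8⟩ := h1
    rw [Matrix.adjugate_fin_three]
    intro i j
    fin_cases i <;> fin_cases j <;>
      simp only [Matrix.of_apply, Matrix.cons_val', Matrix.cons_val_zero, Matrix.cons_val_fin_one,
        Fin.zero_eta, Fin.mk_one, Fin.reduceFinMk, Matrix.cons_val_one, Matrix.cons_val]
    · exact hmod _ _ e0 (by ring)
    · exact hmod _ _ e1 (by ring)
    · exact hmod _ _ e2 (by ring)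
    · exact hmod _ _ e3 (by ring)
    · exact hmod _ _ e4 (by ring)
    · exact hmod _ _ e5 (by ring)
    · exact hmod _ _ e6 (by ring)
    · exact hmod _ _ e7 (by ring)
    · exact hmod _ _ e8 (by ring)

variable {l : List Quad}

lemma hasDenominator_one (h : checkEntries l = true) {v : Fin 1 → Quad}
    (hv : (List.ofFn v).Sublist l) (f : Fin 1 → Fin 4)
    (h0 : (Matrix.of fun i j => (v j).coord (f i)).det ≠ 0) :
    HasDenominator (Matrix.of fun i j => (v j).coord (f i)) 1 := by
  refine hasDenominator_of_det h0 ?_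
  simp only [List.ofFn_succ, List.ofFn_zero] at hv
  obtain ⟨t, h1, -⟩ := exists_of_allSuffixes h hv
  simp only [List.all_cons, List.all_nil, Bool.and_eq_true, Nat.ble_eq, Bool.and_true] at h1
  obtain ⟨e0, e1, e2, e3⟩ := h1
  rw [Matrix.det_fin_one, Matrix.of_apply]
  generalize f 0 = i
  fin_cases i <;> assumption

lemma hasDenominator_two (h : checkMinors2 l = true) {v : Fin 2 → Quad}
    (hv : (List.ofFn v).Sublist l) {f : Fin 2 → Fin 4} (hf : StrictMono f)
    (h0 : (Matrix.of fun i j => (v j).coord (f i)).det ≠ 0) :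
    HasDenominator (Matrix.of fun i j => (v j).coord (f i)) 2 := by
  refine hasDenominator_of_det h0 ?_
  simp only [List.ofFn_succ, List.ofFn_zero] at hv
  obtain ⟨t, h1, hv1⟩ := exists_of_allSuffixes h hv
  obtain ⟨t', h2, -⟩ := exists_of_allSuffixes h1 hv1
  simp only [List.all_cons, List.all_nil, Bool.and_eq_true, Nat.ble_eq, Bool.and_true] at h2
  have hf01 : f 0 < f 1 := hf (by decide)
  have key : ∀ i j : Fin 4, i < j → ((v 0).coord i * (v 1).coord j -
      (v 0).coord j * (v 1).coord i).natAbs ≤ 2 := by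
    obtain ⟨e0, e1, e2, e3, e4, e5⟩ := h2
    intro i j hij
    fin_cases i <;> fin_cases j <;> first | exact absurd hij (by decide) | assumption
  rw [Matrix.det_fin_two]
  simp only [Matrix.of_apply]
  rw [mul_comm ((v 1).coord (f 0))]
  exact key _ _ hf01

lemma exists_hasDenominator_three {N : ℕ} (h : checkMinors3 N l = true) {v : Fin 3 → Quad}
    (hv : (List.ofFn v).Sublist l) {f : Fin 3 → Fin 4} (hf : StrictMono f)
    (h0 : (Matrix.of fun i j => (v j).coord (f i)).det ≠ 0) :
    ∃ g : Fin 3 → Fin 4, HasDenominator (Matrix.of fun i j => (v j).coord (g i)) N := by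
  simp only [List.ofFn_succ, List.ofFn_zero] at hv
  obtain ⟨t, h1, hv1⟩ := exists_of_allSuffixes h hv
  obtain ⟨t', h2, hv2⟩ := exists_of_allSuffixes h1 hv1
  obtain ⟨t'', h3, -⟩ := exists_of_allSuffixes h2 hv2
  simp only [Bool.or_eq_true] at h3
  rcases h3 with h3 | h3 | h3 | h3 | h3
  · exact ⟨![0, 1, 2], hasDenominator_of_smallDet3 _ h3⟩
  · exact ⟨![0, 1, 3], hasDenominator_of_smallDet3 _ h3⟩
  · exact ⟨![0, 2, 3], hasDenominator_of_smallDet3 _ h3⟩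
  · exact ⟨![1, 2, 3], hasDenominator_of_smallDet3 _ h3⟩
  · exfalso
    simp only [List.all_cons, List.all_nil, Bool.and_eq_true, Bool.and_true] at h3
    obtain ⟨e0, e1, e2, e3⟩ := h3
    rw [← det3_eq_det] at h0
    refine h0 (Int.natAbs_eq_zero.1 (Nat.eq_of_beq_eq_true ?_))
    have hf01 : f 0 < f 1 := hf (by decide)
    have hf12 : f 1 < f 2 := hf (by decide)
    simp only [Matrix.of_apply]
    generalize f 0 = i at *
    generalize f 1 = j at *
    generalize f 2 = k at *
    clear hf h0 h
    fin_cases i <;> fin_cases j <;> first | exact absurd hf01 (by decide) | (fin_cases k <;>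
      first | exact absurd hf12 (by decide) | assumption)

lemma hasDenominator_four (h : checkMinors4 l = true) {v : Fin 4 → Quad}
    (hv : (List.ofFn v).Sublist l) {f : Fin 4 → Fin 4} (hf : StrictMono f)
    (h0 : (Matrix.of fun i j => (v j).coord (f i)).det ≠ 0) :
    HasDenominator (Matrix.of fun i j => (v j).coord (f i)) 6 := by
  refine hasDenominator_of_det h0 ?_
  simp only [List.ofFn_succ, List.ofFn_zero] at hv
  obtain ⟨t, h1, hv1⟩ := exists_of_allSuffixes h hv
  obtain ⟨t', h2, hv2⟩ := exists_of_allSuffixes h1 hv1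
  obtain ⟨t'', h3, hv3⟩ := exists_of_allSuffixes h2 hv2
  obtain ⟨t''', h4, -⟩ := exists_of_allSuffixes h3 hv3
  have hid : f = id := by
    have h01 : f 0 < f 1 := hf (by decide)
    have h12 : f 1 < f 2 := hf (by decide)
    have h23 : f 2 < f 3 := hf (by decide)
    have h3 := (f 3).isLt
    rw [Fin.lt_def] at h01 h12 h23
    funext i
    apply Fin.ext
    fin_cases i <;> simp <;> omega
  subst hid
  refine le_of_eq_of_le (congrArg Int.natAbs ?_) (Nat.le_of_ble_eq_true h4)
  simp only [Matrix.det_succ_row_zero, Fin.sum_univ_succ, Matrix.of_apply]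
  simp [Quad.coord, Fin.succAbove, Fin.succ]
  ring

end Minors

/-! ### Torsion bounds for the two arrangements -/

section TorsionBounds

lemma HasDenominator.mono {r : ℕ} {M : Matrix (Fin r) (Fin r) ℤ} {N N' : ℕ}
    (h : HasDenominator M N) (hN : N ≤ N') : HasDenominator M N' := by
  obtain ⟨n, h0, h1, h2⟩ := h
  exact ⟨n, h0, h1.trans hN, h2⟩

/-- The torsion of the quotients by columns of `S` is bounded as soon as the bounds for the minors
of the list of columns are confirmed by evaluation. Matrices with fewer than four rows are padded
with zero rows. -/
lemma exists_killsTorsion {κ : Type} [DecidableEq κ] {m : ℕ} (hm : m ≤ 4)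
    (S : Matrix (Fin m) κ ℤ) (v : κ → Quad) (hv : ∀ i j, S i j = (v j).coord (Fin.castLE hm i))
    (hv0 : ∀ j (i : Fin 4), m ≤ i → (v j).coord i = 0)
    (l : List κ) (hl : ∀ j, j ∈ l) (N : ℕ → ℕ) (h0 : 1 ≤ N 0)
    (h1 : 1 ≤ N 1 ∧ checkEntries (l.map v) = true)
    (h2 : 2 ≤ N 2 ∧ checkMinors2 (l.map v) = true) (h3 : checkMinors3 (N 3) (l.map v) = true)
    (h4 : m = 4 → 6 ≤ N 4 ∧ checkMinors4 (l.map v) = true) (J : Finset κ) :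
    ∃ n, 0 < n ∧ n ≤ N (columnRank S J) ∧ KillsTorsion (columnSpan S J) n := by
  obtain ⟨r, c, f, hr, hsub, hcJ, hspan, hdet⟩ := exists_nonzero_minor S l hl J
  rw [← hr]
  have hM : ∀ g : Fin r → Fin m, S.submatrix g c =
      Matrix.of fun i j => ((v ∘ c) j).coord (Fin.castLE hm (g i)) := by
    intro g; ext i j; simp [hv]
  have hsub' : (List.ofFn (v ∘ c)).Sublist (l.map v) := by
    rw [← List.map_ofFn]; exact hsub.map v
  have hf : StrictMono fun i => Fin.castLE hm (f i) := fun i j hij => by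
    simpa using f.strictMono hij
  have hrm : r ≤ m := by simpa using Fintype.card_le_of_injective f f.injective
  obtain ⟨g, n, hn, hnN, B, hB⟩ : ∃ g : Fin r → Fin m, HasDenominator (S.submatrix g c) (N r) := by
    simp only [hM] at hdet ⊢
    obtain _ | _ | _ | _ | _ | r := r
    · exact ⟨f, 1, one_pos, h0, 0, Subsingleton.elim _ _⟩
    · exact ⟨f, (hasDenominator_one h1.2 hsub' _ hdet).mono h1.1⟩
    · exact ⟨f, (hasDenominator_two h2.2 hsub' hf hdet).mono h2.1⟩
    · obtain ⟨g, hg⟩ := exists_hasDenominator_three h3 hsub' hf hdet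
      have hgm : ∀ s, (g s : ℕ) < m := by
        intro s
        by_contra hs
        exact hg.det_ne_zero (Matrix.det_eq_zero_of_row_eq_zero s fun t =>
          hv0 _ _ (not_lt.1 hs))
      exact ⟨fun s => ⟨g s, hgm s⟩, hg⟩
    · have := h4 (by omega)
      exact ⟨f, (hasDenominator_four this.2 hsub' hf hdet).mono this.1⟩
    · omega
  exact ⟨n, hn, hnN, killsTorsion_of_mul_eq S J c hcJ g hspan B n hB⟩

/-- All hyperplanes of the arrangement `M_m`. -/
def hyperplaneList (m : ℕ) : List (Hyperplanes m) :=
  ((List.finRange m).flatMap fun i => (List.finRange m).flatMap fun j =>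
    if h : i < j then [Sum.inl ⟨(i, j), h⟩] else []) ++
  ((List.finRange m).flatMap fun i => (List.finRange m).flatMap fun j =>
    (List.finRange m).flatMap fun k => (List.finRange m).flatMap fun l =>
      if h : i < j ∧ i < k ∧ k < l ∧ j ≠ k ∧ j ≠ l then [Sum.inr ⟨(i, j, k, l), h⟩] else [])

lemma mem_hyperplaneList {m : ℕ} (H : Hyperplanes m) : H ∈ hyperplaneList m := by
  rw [hyperplaneList, List.mem_append]
  rcases H with ⟨⟨i, j⟩, h⟩ | ⟨⟨i, j, k, l⟩, h⟩
  · left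
    simp only [List.mem_flatMap, List.mem_finRange, true_and]
    exact ⟨i, j, by rw [dif_pos h]; exact List.mem_singleton_self _⟩
  · right
    simp only [List.mem_flatMap, List.mem_finRange, true_and]
    exact ⟨i, j, k, l, by rw [dif_pos h]; exact List.mem_singleton_self _⟩

/-- The first three coefficients of a hyperplane of `M_4`, followed by a zero. -/
def quadFour (H : Hyperplanes 4) : Quad := (normal H 0, normal H 1, normal H 2, 0)

/-- The first four coefficients of a hyperplane of `M_5`. -/
def quadFive (H : Hyperplanes 5) : Quad := (normal H 0, normal H 1, normal H 2, normal H 3)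

/-- The values of `quadFour`. -/
def tableFour : List Quad :=
  [(1, -1, 0, 0), (1, 0, -1, 0), (1, 0, 0, 0), (0, 1, -1, 0), (0, 1, 0, 0), (0, 0, 1, 0),
    (1, 1, -1, 0), (1, -1, 1, 0), (1, -1, -1, 0)]

/-- The values of `quadFive`. -/
def tableFive : List Quad :=
  [(1, -1, 0, 0), (1, 0, -1, 0), (1, 0, 0, -1), (1, 0, 0, 0), (0, 1, -1, 0), (0, 1, 0, -1),
    (0, 1, 0, 0), (0, 0, 1, -1), (0, 0, 1, 0), (0, 0, 0, 1), (1, 1, -1, -1), (1, 1, -1, 0),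
    (1, 1, 0, -1), (1, -1, 1, -1), (1, -1, 1, 0), (1, 0, 1, -1), (1, -1, -1, 1), (1, -1, 0, 1),
    (1, 0, -1, 1), (1, -1, -1, 0), (1, -1, 0, -1), (1, 0, -1, -1), (0, 1, 1, -1), (0, 1, -1, 1),
    (0, 1, -1, -1)]

lemma map_quadFour : (hyperplaneList 4).map quadFour = tableFour := by decide +kernel

lemma map_quadFive : (hyperplaneList 5).map quadFive = tableFive := by decide +kernel

lemma sum_coeffMatrix {m : ℕ} (H : Hyperplanes m) : ∑ i, coeffMatrix m i H = 0 := by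
  rcases H with ⟨⟨i, j⟩, _⟩ | ⟨⟨i, j, k, l⟩, _⟩ <;>
    simp [coeffMatrix, normal, Finset.sum_add_distrib, Finset.sum_sub_distrib]

lemma dropLast_col_ne_zero {m : ℕ} (H : Hyperplanes (m + 1)) :
    (dropLast (coeffMatrix (m + 1))).col H ≠ 0 := by
  -- The first index of a hyperplane is not the last one, and its coefficient is `1`.
  intro h
  rcases H with ⟨⟨i, j⟩, hij⟩ | ⟨⟨i, j, k, l⟩, hij, hik, hkl, _⟩
  · obtain ⟨i', rfl⟩ := Fin.exists_castSucc_eq.2 (hij.trans_le (Fin.le_last j)).ne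
    have := congrFun h i'
    dsimp only at hij
    simp [dropLast, coeffMatrix, normal, hij.ne] at this
  · obtain ⟨i', rfl⟩ := Fin.exists_castSucc_eq.2 (hij.trans_le (Fin.le_last j)).ne
    have := congrFun h i'
    dsimp only at hij hik hkl
    simp [dropLast, coeffMatrix, normal, hij.ne, hik.ne, (hik.trans hkl).ne] at this

/-- A bound for the exponent of the torsion of a quotient by columns of rank `r`, for `M_4`. -/
def torsionBoundFour (r : ℕ) : ℕ := if r ≤ 1 then 1 else 2

/-- A bound for the exponent of the torsion of a quotient by columns of rank `r`, for `M_5`. -/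
def torsionBoundFive (r : ℕ) : ℕ := if r ≤ 1 then 1 else if r ≤ 3 then r else 6

lemma exists_killsTorsion_four (J : Finset (Hyperplanes 4)) :
    ∃ n, 0 < n ∧ n ≤ torsionBoundFour (columnRank (dropLast (coeffMatrix 4)) J) ∧
      KillsTorsion (columnSpan (dropLast (coeffMatrix 4)) J) n := by
  refine exists_killsTorsion (by norm_num) _ quadFour (fun i j => ?_) (fun j i hi => ?_)
    (hyperplaneList 4)
    mem_hyperplaneList torsionBoundFour ?_ ?_ ?_ ?_ ?_ J
  · fin_cases i <;> rfl
  · obtain rfl : i = 3 := Fin.ext (by have := i.isLt; simp; omega)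
    rfl
  · decide
  · rw [map_quadFour]; exact ⟨by decide, by decide +kernel⟩
  · rw [map_quadFour]; exact ⟨by decide, by decide +kernel⟩
  · rw [map_quadFour]; decide +kernel
  · intro h; omega

lemma exists_killsTorsion_five (J : Finset (Hyperplanes 5)) :
    ∃ n, 0 < n ∧ n ≤ torsionBoundFive (columnRank (dropLast (coeffMatrix 5)) J) ∧
      KillsTorsion (columnSpan (dropLast (coeffMatrix 5)) J) n := by
  refine exists_killsTorsion le_rfl _ quadFive (fun i j => ?_) (fun j i hi => ?_)
    (hyperplaneList 5)
    mem_hyperplaneList torsionBoundFive ?_ ?_ ?_ ?_ ?_ J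
  · fin_cases i <;> rfl
  · omega
  · decide
  · rw [map_quadFive]; exact ⟨by decide, by decide +kernel⟩
  · rw [map_quadFive]; exact ⟨by decide, by decide +kernel⟩
  · rw [map_quadFive]; decide +kernel
  · intro _
    rw [map_quadFive]; exact ⟨by decide, by decide +kernel⟩

lemma torsionBoundFour_mono : Monotone torsionBoundFour := by
  intro r s h
  unfold torsionBoundFour
  split_ifs <;> omega

lemma torsionBoundFive_mono : Monotone torsionBoundFive := by
  intro r s h
  unfold torsionBoundFive
  split_ifs <;> omega

lemma IsColumnDivisor.le_torsionBoundFour {J : Finset (Hyperplanes 4)} {d : ℕ}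
    (h : IsColumnDivisor (coeffMatrix 4) J d) : d ≤ torsionBoundFour J.card := by
  obtain ⟨n, hn, hnN, hk⟩ := exists_killsTorsion_four J
  exact (Nat.le_of_dvd hn (h.dvd_of_killsTorsion
    (killsTorsion_of_dropLast sum_coeffMatrix hk))).trans
    (hnN.trans (torsionBoundFour_mono (columnRank_le_card_columns _ J)))

lemma IsColumnDivisor.le_torsionBoundFive {J : Finset (Hyperplanes 5)} {d : ℕ}
    (h : IsColumnDivisor (coeffMatrix 5) J d) : d ≤ torsionBoundFive J.card := by
  obtain ⟨n, hn, hnN, hk⟩ := exists_killsTorsion_five J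
  exact (Nat.le_of_dvd hn (h.dvd_of_killsTorsion
    (killsTorsion_of_dropLast sum_coeffMatrix hk))).trans
    (hnN.trans (torsionBoundFive_mono (columnRank_le_card_columns _ J)))

end TorsionBounds

/-! ### Counting points of the complement -/

section Enumeration

/-- `∑ k < q, f k`, in a form suited to evaluation by the kernel. -/
noncomputable def rangeSum (q : ℕ) (f : ℕ → ℕ) : ℕ :=
  Nat.rec 0 (fun k acc => Nat.add acc (f k)) q

lemma rangeSum_eq (q : ℕ) (f : ℕ → ℕ) : rangeSum q f = ∑ k ∈ Finset.range q, f k := by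
  induction q with
  | zero => rfl
  | succ q ih => rw [Finset.sum_range_succ, ← ih]; rfl

/-- The number whose binary digits equal to `1` are at the residues modulo `q` of the entries. -/
noncomputable def residueMask (q : ℕ) (l : List ℕ) : ℕ :=
  List.rec 0 (fun v _ m => Nat.lor (Nat.pow 2 (Nat.mod v q)) m) l

lemma testBit_residueMask (q : ℕ) (l : List ℕ) (d : ℕ) :
    (residueMask q l).testBit d = true ↔ ∃ v ∈ l, v % q = d := by
  induction l with
  | nil => simp [residueMask]
  | cons v l ih =>
    have : residueMask q (v :: l) = 2 ^ (v % q) ||| residueMask q l := rfl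
    rw [this, Nat.testBit_or, Bool.or_eq_true, ih, Nat.testBit_two_pow]
    simp

/-- The sum of `f d` over the residues `d` modulo `q` that avoid the entries of `l`. -/
noncomputable def sumAvoiding (q : ℕ) (l : List ℕ) (f : ℕ → ℕ) : ℕ :=
  rangeSum q fun d =>
    cond (Nat.beq (Nat.mod (Nat.div (residueMask q l) (Nat.pow 2 d)) 2) 1) 0 (f d)

lemma sumAvoiding_eq (q : ℕ) [NeZero q] (l : List ℕ) (f : ℕ → ℕ) :
    sumAvoiding q l f =
      ∑ x : ZMod q, if x ∈ l.map (Nat.cast : ℕ → ZMod q) then 0 else f x.val := by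
  have hmem : ∀ d < q, (Nat.beq (Nat.mod (Nat.div (residueMask q l) (Nat.pow 2 d)) 2) 1 = true ↔
      (d : ZMod q) ∈ l.map (Nat.cast : ℕ → ZMod q)) := by
    intro d hd
    have h1 := testBit_residueMask q l d
    rw [Nat.testBit_eq_decide_div_mod_eq, decide_eq_true_eq] at h1
    refine (Iff.trans ⟨Nat.eq_of_beq_eq_true, fun h => ?_⟩ h1).trans ?_
    · change Nat.beq (residueMask q l / 2 ^ d % 2) 1 = true
      rw [h]
      rfl
    simp only [List.mem_map]
    refine exists_congr fun v => and_congr_right fun _ => ?_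
    rw [ZMod.natCast_eq_natCast_iff', Nat.mod_eq_of_lt hd]
  rw [sumAvoiding, rangeSum_eq]
  refine Finset.sum_bij' (fun d _ => (d : ZMod q)) (fun x _ => x.val) (by simp)
    (fun x _ => Finset.mem_range.2 (ZMod.val_lt x))
    (fun d hd => ZMod.val_cast_of_lt (Finset.mem_range.1 hd)) (by simp) ?_
  intro d hd
  have hd' := Finset.mem_range.1 hd
  rw [ZMod.val_cast_of_lt hd']
  by_cases h : (d : ZMod q) ∈ l.map (Nat.cast : ℕ → ZMod q)
  · rw [if_pos h, (hmem d hd').2 h]; rfl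
  · rw [if_neg h, Bool.eq_false_iff.2 (mt (hmem d hd').1 h)]; rfl

lemma cast_sub_val {q : ℕ} [NeZero q] (x : ZMod q) : ((Nat.sub q x.val : ℕ) : ZMod q) = -x := by
  change ((q - x.val : ℕ) : ZMod q) = -x
  rw [Nat.cast_sub (ZMod.val_lt x).le]
  simp

lemma sum_fin_succ_fun {X : Type*} [Fintype X] {m : ℕ} (g : (Fin (m + 1) → X) → ℕ) :
    ∑ z, g z = ∑ x, ∑ y : Fin m → X, g (Fin.cons x y) := by
  rw [← Fintype.sum_prod_type']
  exact (Fintype.sum_equiv (Fin.consEquiv fun _ => X) _ _ fun _ => rfl).symm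

/-- The number of points modulo `q` in the complement of `M_4` whose last coordinate is `0`. The
residue `-b` is represented by the natural number `q - b`. -/
noncomputable def countFour (q : ℕ) : ℕ :=
  sumAvoiding q [0] fun a => sumAvoiding q [a, 0] fun b =>
    sumAvoiding q [a, b, 0, Nat.add a b, Nat.add a (Nat.sub q b),
      Nat.add b (Nat.sub q a)] fun _ => 1

/-- The number of points modulo `q` in the complement of `M_5` whose last coordinate is `0`. -/
noncomputable def countFive (q : ℕ) : ℕ :=
  sumAvoiding q [0] fun a => sumAvoiding q [a, 0] fun b =>
    sumAvoiding q [a, b, 0, Nat.add a b, Nat.add a (Nat.sub q b),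
      Nat.add b (Nat.sub q a)] fun c =>
    sumAvoiding q [a, b, c, 0, Nat.add a b, Nat.add a c, Nat.add b c,
      Nat.add a (Nat.sub q b), Nat.add b (Nat.sub q a), Nat.add a (Nat.sub q c),
      Nat.add c (Nat.sub q a), Nat.add b (Nat.sub q c), Nat.add c (Nat.sub q b),
      Nat.add (Nat.add a b) (Nat.sub q c), Nat.add (Nat.add a c) (Nat.sub q b),
      Nat.add (Nat.add b c) (Nat.sub q a)] fun _ => 1

lemma charQuasiPoly_eq_sum_ite {ι κ : Type} [Fintype ι] [DecidableEq ι] [Fintype κ]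
    [DecidableEq κ]
    (S : Matrix ι κ ℤ) (q : ℕ) [NeZero q] (P : (ι → ZMod q) → Prop) [DecidablePred P]
    (hP : ∀ z, z ∈ complementMod S q ↔ P z) :
    charQuasiPoly S q = ∑ z, if P z then 1 else 0 := by
  rw [charQuasiPoly, Nat.card_congr (Equiv.subtypeEquivRight hP), Nat.card_eq_fintype_card,
    Fintype.card_subtype, Finset.card_filter]

lemma sum_ite_cons {X : Type*} [Fintype X] {m : ℕ} (p : X → Prop) [DecidablePred p]
    (Q : (Fin (m + 1) → X) → Prop) [DecidablePred Q] :
    (∑ z, if ¬ p (z 0) ∧ Q z then 1 else 0) =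
      ∑ x, if p x then 0 else ∑ y : Fin m → X, if Q (Fin.cons x y) then 1 else 0 := by
  rw [sum_fin_succ_fun]
  refine Finset.sum_congr rfl fun x _ => ?_
  by_cases h : p x <;> simp [h]

lemma charQuasiPoly_four (q : ℕ) [NeZero q] :
    charQuasiPoly (dropLast (coeffMatrix 4)) q = countFour q := by
  have hcompl : ∀ z : Fin 3 → ZMod q, z ∈ complementMod (dropLast (coeffMatrix 4)) q ↔
      z 0 ∉ [0] ∧ z 1 ∉ [z 0, 0] ∧
      z 2 ∉ [z 0, z 1, 0, z 0 + z 1, z 0 + -z 1, z 1 + -z 0] ∧ True := by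
    intro z
    have h1 : z ∈ complementMod (dropLast (coeffMatrix 4)) q ↔
        ∀ v ∈ tableFour, (v.1 : ZMod q) * z 0 + v.2.1 * z 1 + v.2.2.1 * z 2 ≠ 0 := by
      rw [← map_quadFour, List.forall_mem_map]
      simp only [mem_hyperplaneList, true_imp_iff]
      refine forall_congr' fun H => ?_
      simp [Matrix.vecMul, dotProduct, Fin.sum_univ_succ, dropLast, coeffMatrix, quadFour, mul_comm,
        add_assoc]
    -- The hyperplanes, sorted by the last coordinate that they involve.
    have h2 : tableFour.Perm [(1, 0, 0, 0), (1, -1, 0, 0), (0, 1, 0, 0), (1, 0, -1, 0),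
        (0, 1, -1, 0), (0, 0, 1, 0), (1, 1, -1, 0), (1, -1, -1, 0), (1, -1, 1, 0)] := by decide
    rw [h1]
    simp only [h2.mem_iff]
    simp only [List.forall_mem_cons]
    simp only [List.mem_cons, List.not_mem_nil, not_or, or_false, false_imp_iff, implies_true,
      and_true, and_assoc, ne_eq]
    push_cast
    repeat' apply and_congr
    all_goals
      refine not_congr ⟨fun h => ?_, fun h => ?_⟩ <;>
        first | linear_combination h | linear_combination -h
  rw [charQuasiPoly_eq_sum_ite _ q _ hcompl, countFour]
  simp only [sumAvoiding_eq, List.map_cons, List.map_nil, Nat.cast_zero, ZMod.natCast_val,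
    ZMod.cast_id, Nat.add_eq, Nat.cast_add, cast_sub_val]
  refine (sum_ite_cons (fun x => x ∈ _) _).trans (Finset.sum_congr rfl fun a _ => ?_)
  refine ite_congr rfl (fun _ => rfl) fun _ => ?_
  refine (sum_ite_cons (fun x => x ∈ [a, 0]) _).trans (Finset.sum_congr rfl fun b _ => ?_)
  refine ite_congr rfl (fun _ => rfl) fun _ => ?_
  refine (sum_ite_cons (fun x => x ∈ [a, b, 0, a + b, a + -b, b + -a]) _).trans
    (Finset.sum_congr rfl fun c _ => ?_)
  simp

lemma charQuasiPoly_five (q : ℕ) [NeZero q] :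
    charQuasiPoly (dropLast (coeffMatrix 5)) q = countFive q := by
  have hcompl : ∀ z : Fin 4 → ZMod q, z ∈ complementMod (dropLast (coeffMatrix 5)) q ↔
      z 0 ∉ [0] ∧ z 1 ∉ [z 0, 0] ∧
      z 2 ∉ [z 0, z 1, 0, z 0 + z 1, z 0 + -z 1, z 1 + -z 0] ∧
      z 3 ∉ [z 0, z 1, z 2, 0, z 0 + z 1, z 0 + z 2, z 1 + z 2, z 0 + -z 1, z 1 + -z 0,
        z 0 + -z 2, z 2 + -z 0, z 1 + -z 2, z 2 + -z 1, z 0 + z 1 + -z 2, z 0 + z 2 + -z 1,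
        z 1 + z 2 + -z 0] ∧ True := by
    intro z
    have h1 : z ∈ complementMod (dropLast (coeffMatrix 5)) q ↔ ∀ v ∈ tableFive,
        (v.1 : ZMod q) * z 0 + v.2.1 * z 1 + v.2.2.1 * z 2 + v.2.2.2 * z 3 ≠ 0 := by
      rw [← map_quadFive, List.forall_mem_map]
      simp only [mem_hyperplaneList, true_imp_iff]
      refine forall_congr' fun H => ?_
      simp [Matrix.vecMul, dotProduct, Fin.sum_univ_succ, dropLast, coeffMatrix, quadFive, mul_comm,
        add_assoc]
    -- The hyperplanes, sorted by the last coordinate that they involve.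
    have h2 : tableFive.Perm [(1, 0, 0, 0), (1, -1, 0, 0), (0, 1, 0, 0), (1, 0, -1, 0),
        (0, 1, -1, 0), (0, 0, 1, 0), (1, 1, -1, 0), (1, -1, -1, 0), (1, -1, 1, 0),
        (1, 0, 0, -1), (0, 1, 0, -1), (0, 0, 1, -1), (0, 0, 0, 1), (1, 1, 0, -1), (1, 0, 1, -1),
        (0, 1, 1, -1), (1, -1, 0, -1), (1, -1, 0, 1), (1, 0, -1, -1), (1, 0, -1, 1),
        (0, 1, -1, -1), (0, 1, -1, 1), (1, 1, -1, -1), (1, -1, 1, -1), (1, -1, -1, 1)] := by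
      decide +kernel
    rw [h1]
    simp only [h2.mem_iff]
    simp only [List.forall_mem_cons]
    simp only [List.mem_cons, List.not_mem_nil, not_or, or_false, false_imp_iff, implies_true,
      and_true, and_assoc, ne_eq]
    push_cast
    repeat' apply and_congr
    all_goals
      refine not_congr ⟨fun h => ?_, fun h => ?_⟩ <;>
        first | linear_combination h | linear_combination -h
  rw [charQuasiPoly_eq_sum_ite _ q _ hcompl, countFive]
  simp only [sumAvoiding_eq, List.map_cons, List.map_nil, Nat.cast_zero, ZMod.natCast_val,
    ZMod.cast_id, Nat.add_eq, Nat.cast_add, cast_sub_val]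
  refine (sum_ite_cons (fun x => x ∈ _) _).trans (Finset.sum_congr rfl fun a _ => ?_)
  refine ite_congr rfl (fun _ => rfl) fun _ => ?_
  refine (sum_ite_cons (fun x => x ∈ [a, 0]) _).trans (Finset.sum_congr rfl fun b _ => ?_)
  refine ite_congr rfl (fun _ => rfl) fun _ => ?_
  refine (sum_ite_cons (fun x => x ∈ [a, b, 0, a + b, a + -b, b + -a]) _).trans
    (Finset.sum_congr rfl fun c _ => ?_)
  refine ite_congr rfl (fun _ => rfl) fun _ => ?_
  refine (sum_ite_cons (fun x => x ∈ [a, b, c, 0, a + b, a + c, b + c, a + -b, b + -a, a + -c,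
    c + -a, b + -c, c + -b, a + b + -c, a + c + -b, b + c + -a]) _).trans
    (Finset.sum_congr rfl fun d _ => ?_)
  simp

lemma countFour_eq : countFour 1 = 0 ∧ countFour 2 = 0 ∧ countFour 3 = 0 ∧ countFour 4 = 0 ∧
    countFour 5 = 0 := by
  decide +kernel

lemma countFive_eq_zero : countFive 1 = 0 ∧ countFive 2 = 0 ∧ countFive 3 = 0 ∧ countFive 4 = 0 ∧
    countFive 5 = 0 ∧ countFive 6 = 0 ∧ countFive 7 = 0 ∧ countFive 9 = 0 ∧ countFive 10 = 0 := by
  decide +kernel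

lemma countFive_eq : countFive 11 = 240 ∧ countFive 13 = 1440 ∧ countFive 14 = 3120 := by
  decide +kernel

end Enumeration

/-! ### Interpolation -/

section Interpolation

/-- The coefficients are determined by the values of the quasi-polynomial at `1, …, 5`. -/
lemma charQuasiPoly_dropLast_four (q : ℕ) (hq : 0 < q) :
    (charQuasiPoly (dropLast (coeffMatrix 4)) q : ℤ) =
      q ^ 3 - 9 * q ^ 2 + 23 * q - 15 + if 2 ∣ q then 3 * (q : ℤ) - 9 else 0 := by
  obtain ⟨A, hA0, hA⟩ := exists_charQuasiPoly_coeff _ dropLast_col_ne_zero torsionBoundFour rfl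
    exists_killsTorsion_four
  have hA' : ∀ q : ℕ, 0 < q → (charQuasiPoly (dropLast (coeffMatrix 4)) q : ℤ) =
      q ^ 3 + A 1 1 * q ^ 2 + (A 2 1 + if 2 ∣ q then A 2 2 else 0) * q +
        (A 3 1 + if 2 ∣ q then A 3 2 else 0) := by
    intro q hq
    rw [hA q hq]
    simp only [Fintype.card_fin, Finset.sum_range_succ, Finset.sum_range_zero, torsionBoundFour]
    norm_num [Finset.sum_Icc_succ_top, hA0]
    ring
  have hval : ∀ q : ℕ, 0 < q → (countFour q : ℤ) =
      q ^ 3 + A 1 1 * q ^ 2 + (A 2 1 + if 2 ∣ q then A 2 2 else 0) * q +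
        (A 3 1 + if 2 ∣ q then A 3 2 else 0) := by
    intro q hq
    have : NeZero q := ⟨hq.ne'⟩
    rw [← hA' q hq, charQuasiPoly_four]
  obtain ⟨c1, c2, c3, c4, c5⟩ := countFour_eq
  have h1 := hval 1 (by norm_num)
  have h2 := hval 2 (by norm_num)
  have h3 := hval 3 (by norm_num)
  have h4 := hval 4 (by norm_num)
  have h5 := hval 5 (by norm_num)
  norm_num [c1] at h1
  norm_num [c2] at h2
  norm_num [c3] at h3
  norm_num [c4] at h4
  norm_num [c5] at h5
  have e1 : A 1 1 = -9 := by linarith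
  have e2 : A 2 1 = 23 := by linarith
  have e3 : A 3 1 = -15 := by linarith
  have e4 : A 2 2 = 3 := by linarith
  have e5 : A 3 2 = -9 := by linarith
  rw [hA' q hq, e1, e2, e3, e4, e5]
  split_ifs <;> ring

/-- The coefficients are determined by twelve values of the quasi-polynomial: those at `1`, `7`,
`11`, `13` determine the ones that do not depend on `q`, those at `2`, `10`, `14` the ones that
depend on the parity of `q`, and so on. -/
lemma charQuasiPoly_dropLast_five (q : ℕ) (hq : 0 < q) :
    (charQuasiPoly (dropLast (coeffMatrix 5)) q : ℤ) =
      q ^ 4 - 25 * q ^ 3 + 215 * q ^ 2 - 695 * q + 504 +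
        (if 2 ∣ q then 15 * (q : ℤ) ^ 2 - 225 * q + 600 else 0) +
        (if 3 ∣ q then -40 * (q : ℤ) + 360 else 0) + (if 4 ∣ q then 240 else 0) +
        (if 5 ∣ q then 96 else 0) + (if 6 ∣ q then 120 else 0) := by
  obtain ⟨A, hA0, hA⟩ := exists_charQuasiPoly_coeff _ dropLast_col_ne_zero torsionBoundFive rfl
    exists_killsTorsion_five
  have hA' : ∀ q : ℕ, 0 < q → (charQuasiPoly (dropLast (coeffMatrix 5)) q : ℤ) =
      q ^ 4 + A 1 1 * q ^ 3 + (A 2 1 + if 2 ∣ q then A 2 2 else 0) * q ^ 2 +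
        (A 3 1 + (if 2 ∣ q then A 3 2 else 0) + if 3 ∣ q then A 3 3 else 0) * q +
        (A 4 1 + (if 2 ∣ q then A 4 2 else 0) + (if 3 ∣ q then A 4 3 else 0) +
          (if 4 ∣ q then A 4 4 else 0) + (if 5 ∣ q then A 4 5 else 0) +
          if 6 ∣ q then A 4 6 else 0) := by
    intro q hq
    rw [hA q hq]
    simp only [Fintype.card_fin, Finset.sum_range_succ, Finset.sum_range_zero, torsionBoundFive]
    norm_num [Finset.sum_Icc_succ_top, hA0]
    ring
  have hval : ∀ q : ℕ, 0 < q → (countFive q : ℤ) =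
      q ^ 4 + A 1 1 * q ^ 3 + (A 2 1 + if 2 ∣ q then A 2 2 else 0) * q ^ 2 +
        (A 3 1 + (if 2 ∣ q then A 3 2 else 0) + if 3 ∣ q then A 3 3 else 0) * q +
        (A 4 1 + (if 2 ∣ q then A 4 2 else 0) + (if 3 ∣ q then A 4 3 else 0) +
          (if 4 ∣ q then A 4 4 else 0) + (if 5 ∣ q then A 4 5 else 0) +
          if 6 ∣ q then A 4 6 else 0) := by
    intro q hq
    have : NeZero q := ⟨hq.ne'⟩
    rw [← hA' q hq, charQuasiPoly_five]
  obtain ⟨c1, c2, c3, c4, c5, c6, c7, c9, c10⟩ := countFive_eq_zero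
  obtain ⟨c11, c13, c14⟩ := countFive_eq
  have h1 := hval 1 (by norm_num)
  have h2 := hval 2 (by norm_num)
  have h3 := hval 3 (by norm_num)
  have h4 := hval 4 (by norm_num)
  have h5 := hval 5 (by norm_num)
  have h6 := hval 6 (by norm_num)
  have h7 := hval 7 (by norm_num)
  have h9 := hval 9 (by norm_num)
  have h10 := hval 10 (by norm_num)
  have h11 := hval 11 (by norm_num)
  have h13 := hval 13 (by norm_num)
  have h14 := hval 14 (by norm_num)
  norm_num [c1] at h1
  norm_num [c2] at h2
  norm_num [c3] at h3
  norm_num [c4] at h4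
  norm_num [c5] at h5
  norm_num [c6] at h6
  norm_num [c7] at h7
  norm_num [c9] at h9
  norm_num [c10] at h10
  norm_num [c11] at h11
  norm_num [c13] at h13
  norm_num [c14] at h14
  have e1 : A 1 1 = -25 := by linarith
  have e2 : A 2 1 = 215 := by linarith
  have e3 : A 3 1 = -695 := by linarith
  have e4 : A 4 1 = 504 := by linarith
  have e5 : A 4 5 = 96 := by linarith
  have e6 : A 2 2 = 15 := by linarith
  have e7 : A 3 2 = -225 := by linarith
  have e8 : A 4 2 = 600 := by linarith
  have e9 : A 4 4 = 240 := by linarith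
  have e10 : A 3 3 = -40 := by linarith
  have e11 : A 4 3 = 360 := by linarith
  have e12 : A 4 6 = 120 := by linarith
  rw [hA' q hq, e1, e2, e3, e4, e5, e6, e7, e8, e9, e10, e11, e12]
  split_ifs <;> ring

end Interpolation

/-! ### Generating functions -/

section PowerSeries

/-- The power series `∑ q ^ k * X ^ q` over all multiples `q` of `n`. -/
noncomputable def powerSum (n k : ℕ) : PowerSeries ℤ :=
  PowerSeries.mk fun q => if n ∣ q then (q : ℤ) ^ k else 0

/-- The derivation `X * d/dX` of the ring of power series. -/
noncomputable def eulerDerivation : Derivation ℤ (PowerSeries ℤ) (PowerSeries ℤ) :=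
  (PowerSeries.X : PowerSeries ℤ) • PowerSeries.derivative ℤ

lemma coeff_eulerDerivation (f : PowerSeries ℤ) (q : ℕ) :
    PowerSeries.coeff q (eulerDerivation f) = q * PowerSeries.coeff q f := by
  change PowerSeries.coeff q (PowerSeries.X * PowerSeries.derivative ℤ f) = _
  cases q with
  | zero => simp
  | succ q =>
    rw [PowerSeries.coeff_succ_X_mul, PowerSeries.coeff_derivative]
    push_cast; ring

lemma eulerDerivation_powerSum (n k : ℕ) :
    eulerDerivation (powerSum n k) = powerSum n (k + 1) := by
  ext q
  rw [coeff_eulerDerivation, powerSum, powerSum, PowerSeries.coeff_mk, PowerSeries.coeff_mk]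
  split_ifs <;> ring

lemma eulerDerivation_X_pow (n : ℕ) :
    eulerDerivation ((PowerSeries.X : PowerSeries ℤ) ^ n) =
      (n : PowerSeries ℤ) * PowerSeries.X ^ n := by
  ext q
  rw [coeff_eulerDerivation, ← map_natCast (PowerSeries.C (R := ℤ)), PowerSeries.coeff_C_mul,
    PowerSeries.coeff_X_pow]
  split_ifs with h <;> simp [h]

lemma powerSum_zero_mul {n : ℕ} (hn : 0 < n) :
    powerSum n 0 * (1 - PowerSeries.X ^ n) = 1 := by
  ext q
  rw [mul_sub, mul_one, map_sub, PowerSeries.coeff_mul_X_pow', PowerSeries.coeff_one, powerSum,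
    PowerSeries.coeff_mk]
  simp only [pow_zero, PowerSeries.coeff_mk]
  by_cases hq : n ≤ q
  · rw [if_pos hq, if_neg (by omega : q ≠ 0)]
    have : n ∣ q - n ↔ n ∣ q := Nat.dvd_sub_iff_left hq dvd_rfl
    simp [this]
  · rw [if_neg hq]
    by_cases h0 : q = 0
    · simp [h0]
    · rw [if_neg h0, if_neg (fun h => hq (Nat.le_of_dvd (Nat.pos_of_ne_zero h0) h)), sub_zero]

variable {n : ℕ}

/-- Differentiation of a formula for `powerSum n k`. -/
lemma powerSum_succ_mul {k : ℕ} {p : PowerSeries ℤ}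
    (h : powerSum n k * (1 - PowerSeries.X ^ n) ^ (k + 1) = p) :
    powerSum n (k + 1) * (1 - PowerSeries.X ^ n) ^ (k + 2) =
      eulerDerivation p * (1 - PowerSeries.X ^ n) +
        ((k : PowerSeries ℤ) + 1) * (n : PowerSeries ℤ) * PowerSeries.X ^ n * p := by
  have h1 := congrArg eulerDerivation h
  rw [Derivation.leibniz, Derivation.leibniz_pow, map_sub, Derivation.map_one_eq_zero,
    eulerDerivation_X_pow, eulerDerivation_powerSum] at h1
  simp only [smul_eq_mul, nsmul_eq_mul, Nat.add_sub_cancel] at h1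
  push_cast at h1
  linear_combination (1 - PowerSeries.X ^ n) * h1 +
    (((k : PowerSeries ℤ) + 1) * (n : PowerSeries ℤ) * PowerSeries.X ^ n) * h

lemma powerSum_one_mul (hn : 0 < n) :
    powerSum n 1 * (1 - PowerSeries.X ^ n) ^ 2 = (n : PowerSeries ℤ) * PowerSeries.X ^ n := by
  have h := powerSum_succ_mul (k := 0) (p := 1)
    (by rw [zero_add, pow_one]; exact powerSum_zero_mul hn)
  simp at h
  linear_combination h

lemma powerSum_two_mul (hn : 0 < n) : powerSum n 2 * (1 - PowerSeries.X ^ n) ^ 3 =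
    (n : PowerSeries ℤ) ^ 2 * (PowerSeries.X ^ n + (PowerSeries.X ^ n) ^ 2) := by
  have h := powerSum_succ_mul (powerSum_one_mul hn)
  have hy := eulerDerivation_X_pow n
  generalize (PowerSeries.X : PowerSeries ℤ) ^ n = y at *
  simp [Derivation.leibniz, hy] at h
  linear_combination h

lemma powerSum_three_mul (hn : 0 < n) : powerSum n 3 * (1 - PowerSeries.X ^ n) ^ 4 =
    (n : PowerSeries ℤ) ^ 3 *
      (PowerSeries.X ^ n + 4 * (PowerSeries.X ^ n) ^ 2 + (PowerSeries.X ^ n) ^ 3) := by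
  have h := powerSum_succ_mul (powerSum_two_mul hn)
  have hy := eulerDerivation_X_pow n
  generalize (PowerSeries.X : PowerSeries ℤ) ^ n = y at *
  simp only [Derivation.leibniz, Derivation.leibniz_pow, hy, map_add,
    Derivation.map_natCast, smul_eq_mul, nsmul_eq_mul] at h
  push_cast at h
  linear_combination h

lemma powerSum_four_mul (hn : 0 < n) : powerSum n 4 * (1 - PowerSeries.X ^ n) ^ 5 =
    (n : PowerSeries ℤ) ^ 4 *
      (PowerSeries.X ^ n + 11 * (PowerSeries.X ^ n) ^ 2 + 11 * (PowerSeries.X ^ n) ^ 3 +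
        (PowerSeries.X ^ n) ^ 4) := by
  have h := powerSum_succ_mul (powerSum_three_mul hn)
  have hy := eulerDerivation_X_pow n
  generalize (PowerSeries.X : PowerSeries ℤ) ^ n = y at *
  have h4 : eulerDerivation 4 = 0 := Derivation.map_natCast _ 4
  simp only [Derivation.leibniz, Derivation.leibniz_pow, hy, map_add,
    Derivation.map_natCast, smul_eq_mul, nsmul_eq_mul, h4] at h
  push_cast at h
  linear_combination h

lemma powerSum_five_mul (hn : 0 < n) : powerSum n 5 * (1 - PowerSeries.X ^ n) ^ 6 =
    (n : PowerSeries ℤ) ^ 5 *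
      (PowerSeries.X ^ n + 26 * (PowerSeries.X ^ n) ^ 2 + 66 * (PowerSeries.X ^ n) ^ 3 +
        26 * (PowerSeries.X ^ n) ^ 4 + (PowerSeries.X ^ n) ^ 5) := by
  have h := powerSum_succ_mul (powerSum_four_mul hn)
  have hy := eulerDerivation_X_pow n
  generalize (PowerSeries.X : PowerSeries ℤ) ^ n = y at *
  have h11 : eulerDerivation 11 = 0 := Derivation.map_natCast _ 11
  simp only [Derivation.leibniz, Derivation.leibniz_pow, hy, map_add,
    Derivation.map_natCast, smul_eq_mul, nsmul_eq_mul, h11] at h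
  push_cast at h
  linear_combination h

lemma charQuasiPoly_coeffMatrix_four (q : ℕ) (hq : 0 < q) :
    (charQuasiPoly (coeffMatrix 4) q : ℤ) = q ^ 4 - 9 * q ^ 3 + 23 * q ^ 2 - 15 * q +
      if 2 ∣ q then 3 * (q : ℤ) ^ 2 - 9 * q else 0 := by
  rw [charQuasiPoly_eq_mul_dropLast _ sum_coeffMatrix]
  push_cast
  rw [charQuasiPoly_dropLast_four q hq]
  split_ifs <;> ring

lemma charQuasiPoly_coeffMatrix_five (q : ℕ) (hq : 0 < q) :
    (charQuasiPoly (coeffMatrix 5) q : ℤ) =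
      q ^ 5 - 25 * q ^ 4 + 215 * q ^ 3 - 695 * q ^ 2 + 504 * q +
        (if 2 ∣ q then 15 * (q : ℤ) ^ 3 - 225 * q ^ 2 + 600 * q else 0) +
        (if 3 ∣ q then -40 * (q : ℤ) ^ 2 + 360 * q else 0) + (if 4 ∣ q then 240 * (q : ℤ) else 0) +
        (if 5 ∣ q then 96 * (q : ℤ) else 0) + (if 6 ∣ q then 120 * (q : ℤ) else 0) := by
  rw [charQuasiPoly_eq_mul_dropLast _ sum_coeffMatrix]
  push_cast
  rw [charQuasiPoly_dropLast_five q hq]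
  simp only [mul_add, mul_ite, mul_zero]
  congr 1
  · congr 1
    · congr 1
      · congr 1
        · congr 1
          · ring
          · congr 1; ring
        · congr 1; ring
      · congr 1; ring
    · congr 1; ring
  · congr 1; ring

lemma coeff_const_mul (a : ℤ) (f : PowerSeries ℤ) (q : ℕ) :
    PowerSeries.coeff q ((a : PowerSeries ℤ) * f) = a * PowerSeries.coeff q f := by
  rw [← map_intCast (PowerSeries.C (R := ℤ)), PowerSeries.coeff_C_mul]
  simp

lemma generatingFunction_four : generatingFunction (coeffMatrix 4) =
    (powerSum 1 4 + ((-9 : ℤ) : PowerSeries ℤ) * powerSum 1 3 +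
      ((23 : ℤ) : PowerSeries ℤ) * powerSum 1 2 + ((-15 : ℤ) : PowerSeries ℤ) * powerSum 1 1) +
    (((3 : ℤ) : PowerSeries ℤ) * powerSum 2 2 + ((-9 : ℤ) : PowerSeries ℤ) * powerSum 2 1) := by
  ext q
  simp only [map_add, coeff_const_mul, powerSum, generatingFunction, PowerSeries.coeff_mk,
    one_dvd, if_true]
  rcases Nat.eq_zero_or_pos q with rfl | hq
  · simp
  · rw [if_neg hq.ne', charQuasiPoly_coeffMatrix_four q hq]
    split_ifs <;> ring

lemma generatingFunction_five : generatingFunction (coeffMatrix 5) =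
    (powerSum 1 5 + ((-25 : ℤ) : PowerSeries ℤ) * powerSum 1 4 +
      ((215 : ℤ) : PowerSeries ℤ) * powerSum 1 3 + ((-695 : ℤ) : PowerSeries ℤ) * powerSum 1 2 +
      ((504 : ℤ) : PowerSeries ℤ) * powerSum 1 1) +
    (((15 : ℤ) : PowerSeries ℤ) * powerSum 2 3 + ((-225 : ℤ) : PowerSeries ℤ) * powerSum 2 2 +
      ((600 : ℤ) : PowerSeries ℤ) * powerSum 2 1) +
    (((-40 : ℤ) : PowerSeries ℤ) * powerSum 3 2 + ((360 : ℤ) : PowerSeries ℤ) * powerSum 3 1) +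
    ((240 : ℤ) : PowerSeries ℤ) * powerSum 4 1 + ((96 : ℤ) : PowerSeries ℤ) * powerSum 5 1 +
    ((120 : ℤ) : PowerSeries ℤ) * powerSum 6 1 := by
  ext q
  simp only [map_add, coeff_const_mul, powerSum, generatingFunction, PowerSeries.coeff_mk,
    one_dvd, if_true]
  rcases Nat.eq_zero_or_pos q with rfl | hq
  · simp
  · rw [if_neg hq.ne', charQuasiPoly_coeffMatrix_five q hq]
    simp only [mul_ite, mul_zero]
    split_ifs <;> ring

lemma coe_ofNat_polynomial (k : ℕ) [k.AtLeastTwo] :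
    ((ofNat(k) : ℤ[X]) : PowerSeries ℤ) = ofNat(k) :=
  map_ofNat (Polynomial.coeToPowerSeries.ringHom (R := ℤ)) k

lemma generatingFunction_four_mul :
    generatingFunction (coeffMatrix 4) * (((1 - X) ^ 5 * (1 + X) ^ 3 : ℤ[X]) : PowerSeries ℤ) =
      ((48 * X ^ 6 * (X + 3) : ℤ[X]) : PowerSeries ℤ) := by
  rw [generatingFunction_four]
  have h11 := powerSum_one_mul one_pos
  have h12 := powerSum_two_mul one_pos
  have h13 := powerSum_three_mul one_pos
  have h14 := powerSum_four_mul one_pos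
  have h21 := powerSum_one_mul two_pos
  have h22 := powerSum_two_mul two_pos
  simp only [Polynomial.coe_mul, Polynomial.coe_pow, Polynomial.coe_add, Polynomial.coe_sub,
    Polynomial.coe_X, Polynomial.coe_one, coe_ofNat_polynomial]
  push_cast at *
  generalize (PowerSeries.X : PowerSeries ℤ) = x at *
  linear_combination (1 + x) ^ 3 * (h14 - 9 * (1 - x) * h13 + 23 * (1 - x) ^ 2 * h12 -
    15 * (1 - x) ^ 3 * h11) + (1 - x) ^ 2 * (3 * h22 - 9 * (1 - x ^ 2) * h21)

lemma generatingFunction_five_mul :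
    generatingFunction (coeffMatrix 5) * (denominatorFive : PowerSeries ℤ) =
      (numeratorFive : PowerSeries ℤ) := by
  rw [generatingFunction_five]
  have h11 := powerSum_one_mul one_pos
  have h12 := powerSum_two_mul one_pos
  have h13 := powerSum_three_mul one_pos
  have h14 := powerSum_four_mul one_pos
  have h15 := powerSum_five_mul one_pos
  have h21 := powerSum_one_mul two_pos
  have h22 := powerSum_two_mul two_pos
  have h23 := powerSum_three_mul two_pos
  have h31 := powerSum_one_mul three_pos
  have h32 := powerSum_two_mul three_pos
  have h41 := powerSum_one_mul four_pos
  have h51 := powerSum_one_mul (show 0 < 5 by norm_num)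
  have h61 := powerSum_one_mul (show 0 < 6 by norm_num)
  simp only [denominatorFive, numeratorFive, Polynomial.coe_mul, Polynomial.coe_pow,
    Polynomial.coe_add, Polynomial.coe_sub, Polynomial.coe_X, Polynomial.coe_one,
    coe_ofNat_polynomial]
  push_cast at *
  generalize (PowerSeries.X : PowerSeries ℤ) = x at *
  linear_combination
    (1 + x) ^ 4 * (1 - x + x ^ 2) ^ 2 * (1 + x + x ^ 2) ^ 3 * (1 + x ^ 2) ^ 2 *
      (1 + x + x ^ 2 + x ^ 3 + x ^ 4) ^ 2 *
      (h15 - 25 * (1 - x) * h14 + 215 * (1 - x) ^ 2 * h13 - 695 * (1 - x) ^ 3 * h12 +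
        504 * (1 - x) ^ 4 * h11) +
    (1 - x) ^ 2 * (1 - x + x ^ 2) ^ 2 * (1 + x + x ^ 2) ^ 3 * (1 + x ^ 2) ^ 2 *
      (1 + x + x ^ 2 + x ^ 3 + x ^ 4) ^ 2 *
      (15 * h23 - 225 * (1 - x ^ 2) * h22 + 600 * (1 - x ^ 2) ^ 2 * h21) +
    (1 - x) ^ 3 * (1 + x) ^ 4 * (1 - x + x ^ 2) ^ 2 * (1 + x ^ 2) ^ 2 *
      (1 + x + x ^ 2 + x ^ 3 + x ^ 4) ^ 2 * (-40 * h32 + 360 * (1 - x ^ 3) * h31) +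
    (1 - x) ^ 4 * (1 + x) ^ 2 * (1 - x + x ^ 2) ^ 2 * (1 + x + x ^ 2) ^ 3 *
      (1 + x + x ^ 2 + x ^ 3 + x ^ 4) ^ 2 * (240 * h41) +
    (1 - x) ^ 4 * (1 + x) ^ 4 * (1 - x + x ^ 2) ^ 2 * (1 + x + x ^ 2) ^ 3 * (1 + x ^ 2) ^ 2 *
      (96 * h51) +
    (1 - x) ^ 4 * (1 + x) ^ 2 * (1 + x + x ^ 2) * (1 + x ^ 2) ^ 2 *
      (1 + x + x ^ 2 + x ^ 3 + x ^ 4) ^ 2 * (120 * h61)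

end PowerSeries

/-! ### Column sets with prescribed last elementary divisor -/

section Examples

lemma exists_isColumnDivisor_four_one :
    ∃ J : Finset (Hyperplanes 4), J.Nonempty ∧ J.card = 1 ∧
      IsColumnDivisor (coeffMatrix 4) J 1 :=
  exists_isColumnDivisor (coeffMatrix 4)
    ![Sum.inl ⟨(0, 1), by decide⟩]
    (by decide) (by decide)
    !![1, 0, 0, 0; 1, 1, 0, 0; 0, 0, 1, 0; 0, 0, 0, 1]
    !![1, 0, 0, 0; -1, 1, 0, 0; 0, 0, 1, 0; 0, 0, 0, 1]
    !![1]
    !![1]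
    (by decide) (by decide) ![1] (by decide) (by decide)
    (by decide)

lemma exists_isColumnDivisor_four_two :
    ∃ J : Finset (Hyperplanes 4), J.Nonempty ∧ J.card = 2 ∧
      IsColumnDivisor (coeffMatrix 4) J 2 :=
  exists_isColumnDivisor (coeffMatrix 4)
    ![Sum.inr ⟨(0, 1, 2, 3), by decide⟩,
      Sum.inr ⟨(0, 2, 1, 3), by decide⟩]
    (by decide) (by decide)
    !![1, 0, 0, 0; 1, -1, 0, 0; 0, 1, 1, 0; 1, 0, 0, 1]
    !![1, 0, 0, 0; 1, -1, 0, 0; -1, 1, 1, 0; -1, 0, 0, 1]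
    !![1, -1; 0, 1]
    !![1, 1; 0, 1]
    (by decide) (by decide) ![1, 2] (by decide) (by decide)
    (by decide)

lemma exists_isColumnDivisor_five_one :
    ∃ J : Finset (Hyperplanes 5), J.Nonempty ∧ J.card = 1 ∧
      IsColumnDivisor (coeffMatrix 5) J 1 :=
  exists_isColumnDivisor (coeffMatrix 5)
    ![Sum.inl ⟨(0, 1), by decide⟩]
    (by decide) (by decide)
    !![1, 0, 0, 0, 0; 1, 1, 0, 0, 0; 0, 0, 1, 0, 0; 0, 0, 0, 1, 0; 0, 0, 0, 0, 1]
    !![1, 0, 0, 0, 0; -1, 1, 0, 0, 0; 0, 0, 1, 0, 0; 0, 0, 0, 1, 0; 0, 0, 0, 0, 1]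
    !![1]
    !![1]
    (by decide) (by decide) ![1] (by decide) (by decide)
    (by decide)

lemma exists_isColumnDivisor_five_two :
    ∃ J : Finset (Hyperplanes 5), J.Nonempty ∧ J.card = 2 ∧
      IsColumnDivisor (coeffMatrix 5) J 2 :=
  exists_isColumnDivisor (coeffMatrix 5)
    ![Sum.inr ⟨(0, 1, 2, 3), by decide⟩,
      Sum.inr ⟨(0, 2, 1, 3), by decide⟩]
    (by decide) (by decide)
    !![1, 0, 0, 0, 0; 1, -1, 0, 0, 0; 0, 1, 1, 0, 0; 1, 0, 0, 1, 0; 0, 0, 0, 0, 1]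
    !![1, 0, 0, 0, 0; 1, -1, 0, 0, 0; -1, 1, 1, 0, 0; -1, 0, 0, 1, 0; 0, 0, 0, 0, 1]
    !![1, -1; 0, 1]
    !![1, 1; 0, 1]
    (by decide) (by decide) ![1, 2] (by decide) (by decide)
    (by decide)

lemma exists_isColumnDivisor_five_three :
    ∃ J : Finset (Hyperplanes 5), J.Nonempty ∧ J.card = 3 ∧
      IsColumnDivisor (coeffMatrix 5) J 3 :=
  exists_isColumnDivisor (coeffMatrix 5)
    ![Sum.inr ⟨(0, 1, 2, 3), by decide⟩,
      Sum.inr ⟨(0, 2, 1, 4), by decide⟩,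
      Sum.inr ⟨(1, 3, 2, 4), by decide⟩]
    (by decide) (by decide)
    !![1, 0, 0, 0, 0; -1, 1, 0, 0, 0; 2, -1, 0, 1, 0; 0, 1, 1, 0, 0; 1, 0, 0, 1, 1]
    !![1, 0, 0, 0, 0; 1, 1, 0, 0, 0; -1, -1, 0, 1, 0; -1, 1, 1, 0, 0; 0, -1, -1, 0, 1]
    !![1, 0, -1; 0, 0, 1; 0, 1, 2]
    !![1, 1, 0; 0, -2, 1; 0, 1, 0]
    (by decide) (by decide) ![1, 1, 3] (by decide) (by decide)
    (by decide)

lemma exists_isColumnDivisor_five_four :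
    ∃ J : Finset (Hyperplanes 5), J.Nonempty ∧ J.card = 4 ∧
      IsColumnDivisor (coeffMatrix 5) J 4 :=
  exists_isColumnDivisor (coeffMatrix 5)
    ![Sum.inl ⟨(0, 1), by decide⟩,
      Sum.inr ⟨(0, 1, 2, 3), by decide⟩,
      Sum.inr ⟨(0, 2, 3, 4), by decide⟩,
      Sum.inr ⟨(0, 3, 2, 4), by decide⟩]
    (by decide) (by decide)
    !![1, 0, 0, 0, 0; 1, 1, 0, 0, 0; 1, 1, 0, 1, 0; 2, 2, 1, 3, 0; 1, 1, 1, 1, 1]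
    !![1, 0, 0, 0, 0; -1, 1, 0, 0, 0; 0, 1, -3, 1, 0; 0, -1, 1, 0, 0; 0, -1, 2, -1, 1]
    !![1, -1, 1, -2; 0, 0, 1, -2; 0, 1, -2, 3; 0, 0, 0, 1]
    !![1, 1, 1, 1; 0, 2, 1, 1; 0, 1, 0, 2; 0, 0, 0, 1]
    (by decide) (by decide) ![1, 1, 1, 4] (by decide) (by decide)
    (by decide)

lemma exists_isColumnDivisor_five_five :
    ∃ J : Finset (Hyperplanes 5), J.Nonempty ∧ J.card = 4 ∧
      IsColumnDivisor (coeffMatrix 5) J 5 :=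
  exists_isColumnDivisor (coeffMatrix 5)
    ![Sum.inr ⟨(0, 1, 2, 3), by decide⟩,
      Sum.inr ⟨(0, 2, 1, 4), by decide⟩,
      Sum.inr ⟨(0, 3, 2, 4), by decide⟩,
      Sum.inr ⟨(0, 4, 1, 3), by decide⟩]
    (by decide) (by decide)
    !![1, 0, 0, 0, 0; 1, -1, 0, 0, 0; 1, 0, 1, 0, 0; 3, 2, 4, 1, 0; 1, 1, 1, 1, 1]
    !![1, 0, 0, 0, 0; 1, -1, 0, 0, 0; -1, 0, 1, 0, 0; -1, 2, -4, 1, 0; 0, -1, 3, -1, 1]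
    !![1, -1, 1, -1; 0, 0, 0, 1; 0, 1, -2, 2; 0, 0, 1, -2]
    !![1, 1, 1, 1; 0, 2, 1, 2; 0, 2, 0, 1; 0, 1, 0, 0]
    (by decide) (by decide) ![1, 1, 1, 5] (by decide) (by decide)
    (by decide)

lemma exists_isColumnDivisor_five_six :
    ∃ J : Finset (Hyperplanes 5), J.Nonempty ∧ J.card = 4 ∧
      IsColumnDivisor (coeffMatrix 5) J 6 :=
  exists_isColumnDivisor (coeffMatrix 5)
    ![Sum.inr ⟨(0, 1, 2, 3), by decide⟩,
      Sum.inr ⟨(0, 2, 1, 3), by decide⟩,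
      Sum.inr ⟨(0, 3, 1, 4), by decide⟩,
      Sum.inr ⟨(0, 4, 1, 2), by decide⟩]
    (by decide) (by decide)
    !![1, 0, 0, 0, 0; 1, 0, 1, 0, 0; -1, 0, -2, 1, 0; 1, -1, 2, -2, 0; 1, 1, 1, 1, 1]
    !![1, 0, 0, 0, 0; 1, -2, -2, -1, 0; -1, 1, 0, 0, 0; -1, 2, 1, 0, 0; 0, -1, 1, 1, 1]
    !![1, -1, -1, -3; 0, 0, 0, 1; 0, 1, 0, -2; 0, 0, 1, 4]
    !![1, 1, 1, 1; 0, 2, 1, 0; 0, -4, 0, 1; 0, 1, 0, 0]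
    (by decide) (by decide) ![1, 1, 1, 6] (by decide) (by decide)
    (by decide)

end Examples

/-! ### The arrangements with four and five coordinates -/

section Conclusion

lemma columnDivisors_mono {ι κ : Type} [Fintype ι] [DecidableEq ι] [Fintype κ] [DecidableEq κ]
    (S : Matrix ι κ ℤ) {k l : ℕ} (h : k ≤ l) : columnDivisors S k ⊆ columnDivisors S l :=
  fun _ ⟨J, hJ, hk, hd⟩ => ⟨J, hJ, hk.trans h, hd⟩

lemma mem_columnDivisors_of_card_le {ι κ : Type} [Fintype ι] [DecidableEq ι] [Fintype κ]
    [DecidableEq κ] {S : Matrix ι κ ℤ} {c d k : ℕ}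
    (h : ∃ J : Finset κ, J.Nonempty ∧ J.card = c ∧ IsColumnDivisor S J d) (hk : c ≤ k) :
    d ∈ columnDivisors S k := by
  obtain ⟨J, hJ, rfl, hd⟩ := h
  exact ⟨J, hJ, hk, hd⟩

lemma bounds_of_mem_columnDivisors_four {k d : ℕ} (h : d ∈ columnDivisors (coeffMatrix 4) k) :
    0 < d ∧ d ≤ torsionBoundFour k := by
  obtain ⟨J, -, hk, hd⟩ := h
  exact ⟨hd.pos, hd.le_torsionBoundFour.trans (torsionBoundFour_mono hk)⟩

lemma bounds_of_mem_columnDivisors_five {k d : ℕ} (h : d ∈ columnDivisors (coeffMatrix 5) k) :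
    0 < d ∧ d ≤ torsionBoundFive k := by
  obtain ⟨J, -, hk, hd⟩ := h
  exact ⟨hd.pos, hd.le_torsionBoundFive.trans (torsionBoundFive_mono hk)⟩

lemma columnDivisors_four_one : columnDivisors (coeffMatrix 4) 1 = {1} := by
  refine Set.Subset.antisymm (fun d hd => ?_) ?_
  · obtain ⟨h0, h1⟩ := bounds_of_mem_columnDivisors_four hd
    simp only [torsionBoundFour, Nat.reduceLeDiff, if_true] at h1
    simp only [Set.mem_singleton_iff]
    omega
  · rintro _ rfl
    exact mem_columnDivisors_of_card_le exists_isColumnDivisor_four_one le_rfl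

lemma columnDivisors_four {k : ℕ} (hk : 2 ≤ k) : columnDivisors (coeffMatrix 4) k = {1, 2} := by
  refine Set.Subset.antisymm (fun d hd => ?_) ?_
  · obtain ⟨h0, h1⟩ := bounds_of_mem_columnDivisors_four hd
    rw [torsionBoundFour, if_neg (by omega)] at h1
    simp only [Set.mem_insert_iff, Set.mem_singleton_iff]
    omega
  · rintro _ (rfl | rfl)
    · exact mem_columnDivisors_of_card_le exists_isColumnDivisor_four_one (by omega)
    · exact mem_columnDivisors_of_card_le exists_isColumnDivisor_four_two hk

lemma columnDivisors_five_one : columnDivisors (coeffMatrix 5) 1 = {1} := by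
  refine Set.Subset.antisymm (fun d hd => ?_) ?_
  · obtain ⟨h0, h1⟩ := bounds_of_mem_columnDivisors_five hd
    simp only [torsionBoundFive, Nat.reduceLeDiff, if_true] at h1
    simp only [Set.mem_singleton_iff]
    omega
  · rintro _ rfl
    exact mem_columnDivisors_of_card_le exists_isColumnDivisor_five_one le_rfl

lemma columnDivisors_five_two : columnDivisors (coeffMatrix 5) 2 = {1, 2} := by
  refine Set.Subset.antisymm (fun d hd => ?_) ?_
  · obtain ⟨h0, h1⟩ := bounds_of_mem_columnDivisors_five hd
    simp only [torsionBoundFive, Nat.reduceLeDiff, if_true, if_false] at h1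
    simp only [Set.mem_insert_iff, Set.mem_singleton_iff]
    omega
  · rintro _ (rfl | rfl)
    · exact mem_columnDivisors_of_card_le exists_isColumnDivisor_five_one (by omega)
    · exact mem_columnDivisors_of_card_le exists_isColumnDivisor_five_two le_rfl

lemma columnDivisors_five_three : columnDivisors (coeffMatrix 5) 3 = {1, 2, 3} := by
  refine Set.Subset.antisymm (fun d hd => ?_) ?_
  · obtain ⟨h0, h1⟩ := bounds_of_mem_columnDivisors_five hd
    simp only [torsionBoundFive, Nat.reduceLeDiff, if_true, if_false] at h1
    simp only [Set.mem_insert_iff, Set.mem_singleton_iff]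
    omega
  · rintro _ (rfl | rfl | rfl)
    · exact mem_columnDivisors_of_card_le exists_isColumnDivisor_five_one (by omega)
    · exact mem_columnDivisors_of_card_le exists_isColumnDivisor_five_two (by omega)
    · exact mem_columnDivisors_of_card_le exists_isColumnDivisor_five_three le_rfl

lemma columnDivisors_five {k : ℕ} (hk : 4 ≤ k) :
    columnDivisors (coeffMatrix 5) k = {1, 2, 3, 4, 5, 6} := by
  refine Set.Subset.antisymm (fun d hd => ?_) ?_
  · obtain ⟨h0, h1⟩ := bounds_of_mem_columnDivisors_five hd
    rw [torsionBoundFive, if_neg (by omega), if_neg (by omega)] at h1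
    simp only [Set.mem_insert_iff, Set.mem_singleton_iff]
    omega
  · rintro _ (rfl | rfl | rfl | rfl | rfl | rfl)
    · exact mem_columnDivisors_of_card_le exists_isColumnDivisor_five_one (by omega)
    · exact mem_columnDivisors_of_card_le exists_isColumnDivisor_five_two (by omega)
    · exact mem_columnDivisors_of_card_le exists_isColumnDivisor_five_three (by omega)
    · exact mem_columnDivisors_of_card_le exists_isColumnDivisor_five_four hk
    · exact mem_columnDivisors_of_card_le exists_isColumnDivisor_five_five hk
    · exact mem_columnDivisors_of_card_le exists_isColumnDivisor_five_six hk

/-- The lcm period is `N` as soon as every last elementary divisor divides `N`, and `N` divides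
every common multiple of them. -/
lemma lcmPeriod_eq {ι κ : Type} [Fintype ι] [DecidableEq ι] [Fintype κ] [DecidableEq κ]
    {S : Matrix ι κ ℤ} {N k : ℕ} (hN : 0 < N) (h : ∀ l, ∀ d ∈ columnDivisors S l, d ∣ N)
    (h' : ∀ n, (∀ d ∈ columnDivisors S k, d ∣ n) → N ∣ n) : lcmPeriod S = N := by
  refine IsLeast.csInf_eq ⟨⟨hN, fun J d hJ hd => h _ d ⟨J, hJ, le_rfl, hd⟩⟩, ?_⟩
  rintro n ⟨hn, hdvd⟩
  exact Nat.le_of_dvd hn (h' n fun d ⟨J, hJ, _, hd⟩ => hdvd J d hJ hd)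

lemma lcmPeriod_four : lcmPeriod (coeffMatrix 4) = 2 := by
  refine lcmPeriod_eq (k := 2) two_pos (fun l d hd => ?_) fun n hn => hn 2 ?_
  · have hd' := columnDivisors_mono _ (le_max_left l 2) hd
    rw [columnDivisors_four (le_max_right l 2)] at hd'
    rcases hd' with rfl | rfl <;> norm_num
  · simp [columnDivisors_four le_rfl]

lemma lcmPeriod_five : lcmPeriod (coeffMatrix 5) = 60 := by
  refine lcmPeriod_eq (k := 4) (by norm_num) (fun l d hd => ?_) fun n hn => ?_
  · have hd' := columnDivisors_mono _ (le_max_left l 4) hd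
    rw [columnDivisors_five (le_max_right l 4)] at hd'
    rcases hd' with rfl | rfl | rfl | rfl | rfl | rfl <;> norm_num
  · rw [columnDivisors_five le_rfl] at hn
    have h4 := hn 4 (by simp)
    have h5 := hn 5 (by simp)
    have h6 := hn 6 (by simp)
    omega

lemma generatingFunction_four_mul_pow :
    generatingFunction (coeffMatrix 4) * (((1 - X ^ 2) ^ 5 : ℤ[X]) : PowerSeries ℤ) =
      ((48 * X ^ 6 * (X ^ 3 + 5 * X ^ 2 + 7 * X + 3) : ℤ[X]) : PowerSeries ℤ) := by
  rw [show ((1 - X ^ 2) ^ 5 : ℤ[X]) = (1 - X) ^ 5 * (1 + X) ^ 3 * (1 + X) ^ 2 by ring,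
    show (48 * X ^ 6 * (X ^ 3 + 5 * X ^ 2 + 7 * X + 3) : ℤ[X]) =
      48 * X ^ 6 * (X + 3) * (1 + X) ^ 2 by ring,
    Polynomial.coe_mul, Polynomial.coe_mul _ ((1 + X) ^ 2), ← mul_assoc,
    generatingFunction_four_mul]

/-- The conditions `n ∣ q` that enter the formula for `χ(q)` concern divisors `n` of `60` only. -/
lemma charQuasiPoly_five_eq_eval {q : ℕ} (hq : 0 < q) :
    (charQuasiPoly (coeffMatrix 5) q : ℤ) =
      (constituentFive (Nat.gcd 60 q)).eval (q : ℤ) := by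
  rw [charQuasiPoly_coeffMatrix_five q hq]
  have key : ∀ n, n ∣ 60 → (n ∣ q ↔ n ∣ Nat.gcd 60 q) := fun n hn =>
    ⟨fun h => Nat.dvd_gcd hn h, fun h => h.trans (Nat.gcd_dvd_right _ _)⟩
  simp only [key 2 (by norm_num), key 3 (by norm_num), key 4 (by norm_num),
    key 5 (by norm_num), key 6 (by norm_num)]
  have hg : Nat.gcd 60 q ∈ Nat.divisors 60 :=
    Nat.mem_divisors.2 ⟨Nat.gcd_dvd_left _ _, by norm_num⟩
  rw [show Nat.divisors 60 = {1, 2, 3, 4, 5, 6, 10, 12, 15, 20, 30, 60} by decide] at hg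
  simp only [Finset.mem_insert, Finset.mem_singleton] at hg
  rcases hg with h | h | h | h | h | h | h | h | h | h | h | h <;> rw [h] <;>
    simp [constituentFive] <;> ring

lemma isConstituent_constituentFive {d : ℕ} (hd : d ∣ 60) :
    IsConstituent (coeffMatrix 5) d (constituentFive d) := by
  intro s
  have h0 : 0 < d := Nat.pos_of_dvd_of_pos hd (by norm_num)
  rw [lcmPeriod_five, charQuasiPoly_five_eq_eval (by positivity),
    Nat.gcd_add_mul_left_right, Nat.gcd_eq_right hd]

lemma constituentFive_eq_factored {d : ℕ} (hd : d ∣ 60) :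
    constituentFive d = factoredConstituentFive d := by
  have hg : d ∈ Nat.divisors 60 := Nat.mem_divisors.2 ⟨hd, by norm_num⟩
  rw [show Nat.divisors 60 = {1, 2, 3, 4, 5, 6, 10, 12, 15, 20, 30, 60} by decide] at hg
  simp only [Finset.mem_insert, Finset.mem_singleton] at hg
  rcases hg with rfl | rfl | rfl | rfl | rfl | rfl | rfl | rfl | rfl | rfl | rfl | rfl <;>
    simp only [constituentFive, factoredConstituentFive] <;> ring

end Conclusion

end MidHyperplane

theorem mainTheorem9 :
    -- the arrangement `M_4`
    (columnDivisors (coeffMatrix 4) 1 = {1} ∧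
      columnDivisors (coeffMatrix 4) 2 = {1, 2} ∧
      columnDivisors (coeffMatrix 4) 3 = {1, 2} ∧
      columnDivisors (coeffMatrix 4) 4 = {1, 2} ∧
      lcmPeriod (coeffMatrix 4) = 2 ∧
      (∀ q : ℕ, Odd q →
        (charQuasiPoly (coeffMatrix 4) q : ℤ) = q ^ 4 - 9 * q ^ 3 + 23 * q ^ 2 - 15 * q ∧
        (charQuasiPoly (coeffMatrix 4) q : ℤ) = q * (q - 1) * (q - 3) * (q - 5)) ∧
      (∀ q : ℕ, 0 < q → Even q →
        (charQuasiPoly (coeffMatrix 4) q : ℤ) = q ^ 4 - 9 * q ^ 3 + 26 * q ^ 2 - 24 * q ∧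
        (charQuasiPoly (coeffMatrix 4) q : ℤ) = q * (q - 2) * (q - 3) * (q - 4)) ∧
      generatingFunction (coeffMatrix 4) * (((1 - X ^ 2) ^ 5 : ℤ[X]) : PowerSeries ℤ) =
        ((48 * X ^ 6 * (X ^ 3 + 5 * X ^ 2 + 7 * X + 3) : ℤ[X]) : PowerSeries ℤ) ∧
      generatingFunction (coeffMatrix 4) *
          (((1 - X) ^ 5 * (1 + X) ^ 3 : ℤ[X]) : PowerSeries ℤ) =
        ((48 * X ^ 6 * (X + 3) : ℤ[X]) : PowerSeries ℤ)) ∧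
    -- the arrangement `M_5`
    (columnDivisors (coeffMatrix 5) 1 = {1} ∧
      columnDivisors (coeffMatrix 5) 2 = {1, 2} ∧
      columnDivisors (coeffMatrix 5) 3 = {1, 2, 3} ∧
      columnDivisors (coeffMatrix 5) 4 = {1, 2, 3, 4, 5, 6} ∧
      columnDivisors (coeffMatrix 5) 5 = {1, 2, 3, 4, 5, 6} ∧
      lcmPeriod (coeffMatrix 5) = 60 ∧
      (∀ d : ℕ, d ∣ 60 → IsConstituent (coeffMatrix 5) d (constituentFive d)) ∧
      (∀ q : ℕ, 0 < q → (charQuasiPoly (coeffMatrix 5) q : ℤ) =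
        (constituentFive (Nat.gcd 60 q)).eval (q : ℤ)) ∧
      (∀ d : ℕ, d ∣ 60 → constituentFive d = factoredConstituentFive d) ∧
      (∀ p ∈ ([(2, 5), (3, 5), (4, 5), (5, 6), (5, 12)] : List (ℕ × ℕ)),
        constituentFive p.1 + constituentFive p.2 - constituentFive (p.1 * p.2) -
          constituentFive 1 = 0) ∧
      (∀ p ∈ ([(2, 3), (2, 15), (3, 4), (3, 10), (3, 20), (4, 15)] : List (ℕ × ℕ)),
        constituentFive p.1 + constituentFive p.2 - constituentFive (p.1 * p.2) -
          constituentFive 1 = -120 * X) ∧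
      generatingFunction (coeffMatrix 5) *
          (denominatorFive : PowerSeries ℤ) = (numeratorFive : PowerSeries ℤ)) := by
  refine ⟨⟨columnDivisors_four_one, columnDivisors_four le_rfl, columnDivisors_four (by norm_num),
    columnDivisors_four (by norm_num), lcmPeriod_four, fun q hq => ?_, fun q h0 hq => ?_,
    generatingFunction_four_mul_pow, generatingFunction_four_mul⟩,
    columnDivisors_five_one, columnDivisors_five_two, columnDivisors_five_three,
    columnDivisors_five le_rfl, columnDivisors_five (by norm_num), lcmPeriod_five,
    fun d hd => isConstituent_constituentFive hd, fun q hq => charQuasiPoly_five_eq_eval hq,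
    fun d hd => constituentFive_eq_factored hd, ?_, ?_, generatingFunction_five_mul⟩
  · rw [charQuasiPoly_coeffMatrix_four q hq.pos,
      if_neg (fun h => (Nat.not_even_iff_odd.2 hq) (even_iff_two_dvd.2 h))]
    constructor <;> ring
  · rw [charQuasiPoly_coeffMatrix_four q h0, if_pos hq.two_dvd]
    constructor <;> ring
  · simp only [List.forall_mem_cons, List.not_mem_nil, false_imp_iff, implies_true, and_true,
      Nat.reduceMul, constituentFive]
    refine ⟨?_, ?_, ?_, ?_, ?_⟩ <;> ring
  · simp only [List.forall_mem_cons, List.not_mem_nil, false_imp_iff, implies_true, and_true,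
      Nat.reduceMul, constituentFive]
    refine ⟨?_, ?_, ?_, ?_, ?_, ?_⟩ <;> ring
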